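/- Let $I=[a,b]$ with $a<b$, and let $\ell,d\in C^2(I)$ be real-valued functions with $\ell(t)>0$ for all $t\in I$. Let $\Omega=[-\tfrac12,\tfrac12]$, and on $L^2(\Omega)$ let $\Delta_{\mathrm{Dir}}\Psi=-\Psi''$ be the (nonnegative) Dirichlet Laplacian with domain $\mathcal D_{\mathrm{Dir}}(\Omega)=\mathrm H^1_0(\Omega)\cap \mathrm H^2(\Omega)$; let $(p\Psi)(x)=-\mathrm i\Psi'(x)$, $(x\Psi)(x)=x\Psi(x)$ and $x\circ p=\tfrac12(xp+px)$. For $t\in I$ define the operator $$\tilde H(t)=\frac{1}{\ell(t)^2}\Delta_{\mathrm{Dir}}-\frac{\dot\ell(t)}{\ell(t)}\,x\circ p-\frac{\dot d(t)}{\ell(t)}\,p,\qquad \mathcal D(\tilde H(t))=\mathcal D_{\mathrm{Dir}}(\Omega).$$ Then: 1. $\tilde H(t)$ is self-adjoint for every $t\in I$, and the family is semibounded from below uniformly in $t$: there is $m\in\mathbb R$ with $\langle\Psi,\tilde H(t)\Psi\rangle\ge -m\|\Psi\|^2$ for all $t\in I$ and $\Psi\in\mathcal D_{\mathrm{Dir}}(\Omega)$.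 The form domain of $\tilde H(t)$ is $\mathcal H^+=\mathrm H^1_0(\Omega)$ for every $t\in I$. 2. The Schrödinger equation $\mathrm i\dot\Psi(t)=\tilde H(t)\Psi(t)$ has a unique weak solution $\tilde U(t,s)$, $t,s\in I$. That is, there is exactly one family $\{\tilde U(t,s)\}_{t,s\in I}$ of operators on $L^2(\Omega)$ such that: each $\tilde U(t,s)$ is unitary; $\tilde U(t,s)\tilde U(s,r)=\tilde U(t,r)$ for all $t,s,r\in I$; $(t,s)\mapsto\tilde U(t,s)$ is jointly strongly continuous on $I\times I$; and for all $s\in I$ and $\Psi_0\in\mathcal H^+$ the function $\Psi(t)=\tilde U(t,s)\Psi_0$ takes values in $\mathcal H^+$, satisfies $\Psi(s)=\Psi_0$, and for all $\Phi\in\mathcal H^+$ and $t\in I$ $$\mathrm i\frac{\mathrm d}{\mathrm dt}\langle\Phi,\Psi(t)\rangle=\tilde h_t(\Phi,\Psi(t)),$$ where $\tilde h_t$ is the closed sesquilinear form on $\mathcal H^+$ associated with $\tilde H(t)$. (All derivatives with respect to $t$ at the end points of $I$ are one-sided.) -/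

import Mathlib

open Set Filter Topology MeasureTheory
open scoped InnerProductSpace ContDiff

namespace MovingBox

noncomputable section

section Abstract

variable {E : Type*} [NormedAddCommGroup E] [InnerProductSpace ℂ E]

/-- A family of bounded operators `U t s`, relevant only for `t, s ∈ I`, is a unitary propagator
on `I`: each `U t s` is unitary, `U t s ∘ U s r = U t r`, and `(t, s) ↦ U t s` is jointly strongly
continuous on `I × I`. -/
structure IsUnitaryPropagator [CompleteSpace E] (I : Set ℝ) (U : ℝ → ℝ → E →L[ℂ] E) : Prop where
  unitary_mem : ∀ t ∈ I, ∀ s ∈ I, U t s ∈ unitary (E →L[ℂ] E)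
  comp_eq : ∀ t ∈ I, ∀ s ∈ I, ∀ r ∈ I, U t s * U s r = U t r
  strongly_continuous : ∀ Ψ : E, ContinuousOn (fun q : ℝ × ℝ => U q.1 q.2 Ψ) (I ×ˢ I)

/-- The family of operators `H t`, `t ∈ I`, is semibounded from below uniformly in `t`. -/
def IsUniformlySemibounded (I : Set ℝ) (H : ℝ → E →ₗ.[ℂ] E) : Prop :=
  ∃ m : ℝ, ∀ t ∈ I, ∀ Ψ : (H t).domain, -m * ‖(Ψ : E)‖ ^ 2 ≤ (⟪(Ψ : E), H t Ψ⟫_ℂ).re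

/-- A sequence of vectors of the domain of `A` that converges to `Ψ` in the Hilbert space and is a
Cauchy sequence for the quadratic form `⟪·, A ·⟫`. -/
def IsFormApprox (A : E →ₗ.[ℂ] E) (u : ℕ → A.domain) (Ψ : E) : Prop :=
  Tendsto (fun n => (u n : E)) atTop (𝓝 Ψ) ∧
    Tendsto (fun q : ℕ × ℕ => ⟪((u q.1 - u q.2 : A.domain) : E), A (u q.1 - u q.2)⟫_ℂ)
      atTop (𝓝 0)

/-- The form domain of a semibounded self-adjoint operator `A`: the domain of the closure of the
quadratic form `Ψ ↦ ⟪Ψ, A Ψ⟫`, `Ψ ∈ 𝓓(A)`. -/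
def formDomain (A : E →ₗ.[ℂ] E) : Set E :=
  {Ψ | ∃ u : ℕ → A.domain, IsFormApprox A u Ψ}

/-- `HasFormValue A Φ Ψ z`: the vectors `Φ`, `Ψ` belong to the form domain of `A`, and the
(closed) sesquilinear form of `A`, i.e. the extension of `(Φ, Ψ) ↦ ⟪Φ, A Ψ⟫` to the form domain by
form-continuity, takes the value `z` at `(Φ, Ψ)`. -/
def HasFormValue (A : E →ₗ.[ℂ] E) (Φ Ψ : E) (z : ℂ) : Prop :=
  Φ ∈ formDomain A ∧ Ψ ∈ formDomain A ∧
    ∀ u v : ℕ → A.domain, IsFormApprox A u Φ → IsFormApprox A v Ψ →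
      Tendsto (fun n => ⟪(u n : E), A (v n)⟫_ℂ) atTop (𝓝 z)

/-- The form value at `(Φ, Ψ)` is unique. -/
theorem HasFormValue.unique {A : E →ₗ.[ℂ] E} {Φ Ψ : E} {z w : ℂ}
    (hz : HasFormValue A Φ Ψ z) (hw : HasFormValue A Φ Ψ w) : z = w := by
  obtain ⟨⟨u, hu⟩, ⟨v, hv⟩, h⟩ := hz
  exact tendsto_nhds_unique (h u v hu hv) (hw.2.2 u v hu hv)

/-- `U` is a weak solution on `I` of the Schrödinger equation generated by `H t`, where `Hplus` is
the (time-independent) form domain of the operators `H t`: `U` is a unitary propagator and, for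
every initial time `s` and every `Ψ₀ ∈ Hplus`, the function `Ψ t = U t s Ψ₀` satisfies `Ψ s = Ψ₀`
and `i d/dt ⟪Φ, Ψ t⟫ = h_t (Φ, Ψ t)` for all `t ∈ I` and all `Φ ∈ Hplus`, with `h_t` the
sesquilinear form of `H t` (in particular `Ψ t` is in the form domain). At the end points of `I`
the derivative is one-sided. -/
structure IsWeakSolution [CompleteSpace E] (I : Set ℝ) (H : ℝ → E →ₗ.[ℂ] E) (Hplus : Set E)
    (U : ℝ → ℝ → E →L[ℂ] E) : Prop where
  propagator : IsUnitaryPropagator I U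
  initial : ∀ s ∈ I, ∀ Ψ₀ ∈ Hplus, U s s Ψ₀ = Ψ₀
  equation : ∀ s ∈ I, ∀ Ψ₀ ∈ Hplus, ∀ Φ ∈ Hplus, ∀ t ∈ I, ∃ z : ℂ,
    HasDerivWithinAt (fun τ => ⟪Φ, U τ s Ψ₀⟫_ℂ) z I t ∧
      HasFormValue (H t) Φ (U t s Ψ₀) (Complex.I * z)

end Abstract

section UnitInterval

/-- The unit interval centred at the origin (end points are irrelevant for `L²`). -/
def Omega : Set ℝ := Ioo (-(1 / 2)) (1 / 2)

/-- The Hilbert space `L²(Ω)` of complex-valued functions. -/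
abbrev L2 : Type := Lp ℂ 2 (volume.restrict Omega)

/-- `φ` is a complex-valued smooth function with compact support in the open interval `Ω`. -/
structure IsTestFunction (φ : ℝ → ℂ) : Prop where
  smooth : ContDiff ℝ ∞ φ
  compact : HasCompactSupport φ
  support_subset : tsupport φ ⊆ Omega

theorem IsTestFunction.add {φ ψ : ℝ → ℂ} (hφ : IsTestFunction φ) (hψ : IsTestFunction ψ) :
    IsTestFunction (φ + ψ) :=
  ⟨hφ.smooth.add hψ.smooth, hφ.compact.add hψ.compact,
    (tsupport_add φ ψ).trans (union_subset hφ.support_subset hψ.support_subset)⟩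

theorem IsTestFunction.const_smul {φ : ℝ → ℂ} (c : ℂ) (hφ : IsTestFunction φ) :
    IsTestFunction (c • φ) := by
  have h : tsupport (c • φ) ⊆ tsupport φ :=
    closure_mono (Function.support_const_smul_subset c φ)
  exact ⟨contDiff_const.smul hφ.smooth,
    hφ.compact.of_isClosed_subset (isClosed_tsupport _) h, h.trans hφ.support_subset⟩

theorem IsTestFunction.zero : IsTestFunction 0 :=
  ⟨contDiff_const, HasCompactSupport.zero, by simp [tsupport]⟩

theorem IsTestFunction.mul_id {φ : ℝ → ℂ} (hφ : IsTestFunction φ) :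
    IsTestFunction (fun x : ℝ => (x : ℂ) * φ x) := by
  have h : tsupport (fun x : ℝ => (x : ℂ) * φ x) ⊆ tsupport φ := tsupport_mul_subset_right
  exact ⟨Complex.ofRealCLM.contDiff.mul hφ.smooth,
    hφ.compact.of_isClosed_subset (isClosed_tsupport _) h, h.trans hφ.support_subset⟩

theorem IsTestFunction.deriv {φ : ℝ → ℂ} (hφ : IsTestFunction φ) :
    IsTestFunction (_root_.deriv φ) :=
  ⟨(contDiff_infty_iff_deriv.1 hφ.smooth).2, hφ.compact.deriv,
    tsupport_deriv_subset.trans hφ.support_subset⟩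

theorem IsTestFunction.memLp {φ : ℝ → ℂ} (hφ : IsTestFunction φ) :
    MemLp φ 2 (volume.restrict Omega) :=
  (hφ.smooth.continuous.memLp_of_hasCompactSupport hφ.compact).restrict _

theorem integrable_mul_test (u : L2) {φ : ℝ → ℂ} (hφ : IsTestFunction φ) :
    Integrable (fun x => u x * φ x) (volume.restrict Omega) :=
  (Lp.memLp u).integrable_mul hφ.memLp

/-- `v` is the weak derivative of `u` on `Ω`. -/
def IsWeakDeriv (u v : L2) : Prop :=
  ∀ φ : ℝ → ℂ, IsTestFunction φ →
    (∫ x in Omega, u x * deriv φ x) = - ∫ x in Omega, v x * φ x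

/-- The graph of the weak derivative in `L²(Ω)`. -/
def weakDerivGraph : Submodule ℂ (L2 × L2) where
  carrier := {q | IsWeakDeriv q.1 q.2}
  zero_mem' := by
    intro φ hφ
    have h0 : ∀ ψ : ℝ → ℂ, ∫ x in Omega, (0 : L2) x * ψ x = 0 := by
      intro ψ
      rw [integral_congr_ae (g := fun _ => (0 : ℂ)), integral_zero]
      filter_upwards [Lp.coeFn_zero ℂ 2 (volume.restrict Omega)] with x hx
      rw [hx, Pi.zero_apply, zero_mul]
    change ∫ x in Omega, (0 : L2) x * deriv φ x = - ∫ x in Omega, (0 : L2) x * φ x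
    rw [h0, h0, neg_zero]
  add_mem' := by
    intro p q hp hq φ hφ
    have hadd : ∀ (u v : L2) (ψ : ℝ → ℂ), IsTestFunction ψ →
        ∫ x in Omega, (u + v : L2) x * ψ x =
          (∫ x in Omega, u x * ψ x) + ∫ x in Omega, v x * ψ x := by
      intro u v ψ hψ
      rw [← integral_add (integrable_mul_test u hψ) (integrable_mul_test v hψ)]
      refine integral_congr_ae ?_
      filter_upwards [Lp.coeFn_add u v] with x hx
      rw [hx, Pi.add_apply, add_mul]
    change ∫ x in Omega, (p.1 + q.1 : L2) x * deriv φ x =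
      - ∫ x in Omega, (p.2 + q.2 : L2) x * φ x
    rw [hadd _ _ _ hφ.deriv, hadd _ _ _ hφ, hp φ hφ, hq φ hφ, neg_add]
  smul_mem' := by
    intro c p hp φ hφ
    have hsmul : ∀ (u : L2) (ψ : ℝ → ℂ),
        ∫ x in Omega, (c • u : L2) x * ψ x = c * ∫ x in Omega, u x * ψ x := by
      intro u ψ
      rw [← integral_const_mul]
      refine integral_congr_ae ?_
      filter_upwards [Lp.coeFn_smul c u] with x hx
      simp [hx, mul_assoc]
    change ∫ x in Omega, (c • p.1 : L2) x * deriv φ x = - ∫ x in Omega, (c • p.2 : L2) x * φ x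
    rw [hsmul, hsmul, hp φ hφ, mul_neg]

/-- A function has at most one weak derivative. -/
theorem weakDerivGraph_snd_eq_zero (q : L2 × L2) (hq : q ∈ weakDerivGraph) (h0 : q.1 = 0) :
    q.2 = 0 := by
  have key : ∀ᵐ x ∂(volume : Measure ℝ), x ∈ Omega → q.2 x = 0 := by
    refine (isOpen_Ioo : IsOpen Omega).ae_eq_zero_of_integral_contDiff_smul_eq_zero ?_ ?_
    · have : IntegrableOn (q.2 : ℝ → ℂ) Omega volume :=
        haveI : IsFiniteMeasure (volume.restrict Omega) :=
          ⟨by rw [Measure.restrict_apply_univ]; exact measure_Ioo_lt_top⟩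
        (Lp.memLp q.2).integrable (by norm_num)
      exact this.locallyIntegrableOn
    · intro g hg hgc hgs
      have hs : Function.support (fun x => (g x : ℂ)) = Function.support g := by
        ext x; simp
      have hts : tsupport (fun x => (g x : ℂ)) = tsupport g := by
        simp only [tsupport, hs]
      have ht : IsTestFunction (fun x => (g x : ℂ)) :=
        ⟨Complex.ofRealCLM.contDiff.comp hg, by
          unfold HasCompactSupport; rw [hts]; exact hgc, by rw [hts]; exact hgs⟩
      have h1 : ∫ x in Omega, q.1 x * deriv (fun x => (g x : ℂ)) x = 0 := by
        rw [integral_congr_ae (g := fun _ => (0 : ℂ)), integral_zero]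
        rw [h0]
        filter_upwards [Lp.coeFn_zero ℂ 2 (volume.restrict Omega)] with x hx
        rw [hx, Pi.zero_apply, zero_mul]
      have h2 := hq _ ht
      rw [h1, eq_comm, neg_eq_zero] at h2
      rw [← h2, ← setIntegral_eq_integral_of_forall_compl_eq_zero (s := Omega)]
      · refine integral_congr_ae (ae_of_all _ fun x => ?_)
        simp [mul_comm]
      · intro x hx
        have : g x = 0 := by
          by_contra hne
          exact hx (hgs (subset_tsupport g hne))
        simp [this]
  rw [Lp.eq_zero_iff_ae_eq_zero]
  exact (ae_restrict_iff' measurableSet_Ioo).2 key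

/-- The weak derivative as an unbounded operator in `L²(Ω)`. -/
def weakDeriv : L2 →ₗ.[ℂ] L2 := weakDerivGraph.toLinearPMap

/-- The Sobolev space `H¹(Ω)`: functions in `L²(Ω)` with a weak derivative in `L²(Ω)`. -/
def H1 : Submodule ℂ L2 := weakDeriv.domain

/-- The operator `Ψ ↦ Ψ'` on `H¹(Ω)`. -/
def dx : H1 →ₗ[ℂ] L2 := weakDeriv.toFun

theorem mem_H1_iff {u : L2} : u ∈ H1 ↔ ∃ v, IsWeakDeriv u v := by
  simp only [H1, weakDeriv, Submodule.toLinearPMap_domain, Submodule.mem_map, Prod.exists,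
    LinearMap.fst_apply, exists_and_right, exists_eq_right]
  rfl

theorem isWeakDeriv_dx (u : H1) : IsWeakDeriv (u : L2) (dx u) :=
  Submodule.mem_graph_toLinearPMap weakDerivGraph_snd_eq_zero u

theorem dx_eq {u : H1} {v : L2} (h : IsWeakDeriv (u : L2) v) : dx u = v := by
  have h1 : ((u : L2), dx u) - ((u : L2), v) ∈ weakDerivGraph :=
    weakDerivGraph.sub_mem (isWeakDeriv_dx u) h
  exact sub_eq_zero.1 (weakDerivGraph_snd_eq_zero _ h1 (sub_self _))

/-- The Sobolev space `H²(Ω)`: functions in `H¹(Ω)` whose derivative is in `H¹(Ω)`. -/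
def H2 : Submodule ℂ L2 := (H1.comap dx).map H1.subtype

theorem mem_H2_iff {u : L2} : u ∈ H2 ↔ ∃ h : u ∈ H1, dx ⟨u, h⟩ ∈ H1 := by
  simp [H2]

/-- The pairs `(φ, φ')` with `φ` smooth and compactly supported in `Ω`. -/
def testGraph : Submodule ℂ (L2 × L2) where
  carrier := {q | ∃ φ : ℝ → ℂ, IsTestFunction φ ∧
    q.1 =ᵐ[volume.restrict Omega] φ ∧ q.2 =ᵐ[volume.restrict Omega] deriv φ}
  zero_mem' := by
    refine ⟨0, IsTestFunction.zero, Lp.coeFn_zero ℂ 2 _, ?_⟩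
    have : deriv (0 : ℝ → ℂ) = 0 := by ext x; simp
    rw [this]
    exact Lp.coeFn_zero ℂ 2 _
  add_mem' := by
    rintro p q ⟨φ, hφ, hp1, hp2⟩ ⟨ψ, hψ, hq1, hq2⟩
    refine ⟨φ + ψ, hφ.add hψ, (Lp.coeFn_add _ _).trans (hp1.add hq1), ?_⟩
    have : deriv (φ + ψ) = deriv φ + deriv ψ := by
      ext x
      exact deriv_add (hφ.smooth.differentiable (by simp) x)
        (hψ.smooth.differentiable (by simp) x)
    rw [this]
    exact (Lp.coeFn_add _ _).trans (hp2.add hq2)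
  smul_mem' := by
    rintro c p ⟨φ, hφ, hp1, hp2⟩
    refine ⟨c • φ, hφ.const_smul c, (Lp.coeFn_smul _ _).trans (hp1.const_smul c), ?_⟩
    have : deriv (c • φ) = c • deriv φ := by
      ext x
      exact deriv_const_smul c (hφ.smooth.differentiable (by simp) x)
    rw [this]
    exact (Lp.coeFn_smul _ _).trans (hp2.const_smul c)

/-- The Sobolev space `H¹₀(Ω)`: the closure in `H¹(Ω)` of the smooth functions with compact support
in `Ω`; that is, the functions `u` with a weak derivative `v` such that `(u, v)` is a limit in
`L²(Ω) × L²(Ω)` of pairs `(φ, φ')`. -/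
def H10 : Submodule ℂ L2 :=
  (weakDerivGraph ⊓ testGraph.topologicalClosure).map (LinearMap.fst ℂ L2 L2)

/-- The Dirichlet domain `H¹₀(Ω) ∩ H²(Ω)`. -/
def DDir : Submodule ℂ L2 := H10 ⊓ H2

theorem DDir_le_H1 : DDir ≤ H1 := fun _ hu => (mem_H2_iff.1 hu.2).1

theorem dx_mem_H1 (u : DDir) : dx (Submodule.inclusion DDir_le_H1 u) ∈ H1 :=
  (mem_H2_iff.1 u.2.2).2

/-- The nonnegative Dirichlet Laplacian `Ψ ↦ -Ψ''` on the Dirichlet domain. -/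
def laplacianDir : DDir →ₗ[ℂ] L2 :=
  -(dx ∘ₗ (dx ∘ₗ Submodule.inclusion DDir_le_H1).codRestrict H1 dx_mem_H1)

/-- The momentum operator `(p Ψ)(x) = -i Ψ'(x)` on `H¹(Ω)`. -/
def momentum : H1 →ₗ[ℂ] L2 := (-Complex.I) • dx

theorem memLp_position (u : L2) :
    MemLp (fun x : ℝ => (x : ℂ) * u x) 2 (volume.restrict Omega) := by
  have hm : AEStronglyMeasurable (fun x : ℝ => (x : ℂ)) (volume.restrict Omega) :=
    Complex.continuous_ofReal.aestronglyMeasurable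
  refine MemLp.of_le (Lp.memLp u) (hm.mul (Lp.aestronglyMeasurable u)) ?_
  refine (ae_restrict_iff' measurableSet_Ioo).2 (ae_of_all _ fun x hx => ?_)
  rw [norm_mul]
  refine mul_le_of_le_one_left (norm_nonneg _) ?_
  rw [Complex.norm_real, Real.norm_eq_abs, abs_le]
  constructor <;> linarith [hx.1, hx.2]

/-- The position operator `(x Ψ)(x) = x Ψ(x)`. -/
def position : L2 →ₗ[ℂ] L2 where
  toFun u := (memLp_position u).toLp _
  map_add' u v := by
    refine Lp.ext ?_
    filter_upwards [(memLp_position (u + v)).coeFn_toLp, (memLp_position u).coeFn_toLp,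
      (memLp_position v).coeFn_toLp, Lp.coeFn_add u v,
      Lp.coeFn_add ((memLp_position u).toLp _) ((memLp_position v).toLp _)] with x h1 h2 h3 h4 h5
    rw [h1, h5, Pi.add_apply, h2, h3, h4, Pi.add_apply, mul_add]
  map_smul' c u := by
    refine Lp.ext ?_
    filter_upwards [(memLp_position (c • u)).coeFn_toLp, (memLp_position u).coeFn_toLp,
      Lp.coeFn_smul c u, Lp.coeFn_smul c ((memLp_position u).toLp _)] with x h1 h2 h3 h4
    rw [RingHom.id_apply, h1, h4, Pi.smul_apply, h2, h3, Pi.smul_apply, smul_eq_mul, smul_eq_mul]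
    ring

theorem coeFn_position (u : L2) :
    position u =ᵐ[volume.restrict Omega] fun x : ℝ => (x : ℂ) * u x :=
  (memLp_position u).coeFn_toLp

/-- Multiplication by `x` preserves `H¹(Ω)`. -/
theorem position_mem_H1 {u : L2} (hu : u ∈ H1) : position u ∈ H1 := by
  obtain ⟨v, hv⟩ := mem_H1_iff.1 hu
  refine mem_H1_iff.2 ⟨u + position v, fun φ hφ => ?_⟩
  have hd : ∀ x : ℝ, deriv (fun x : ℝ => (x : ℂ) * φ x) x = φ x + x * deriv φ x := by
    intro x
    have h1 : HasDerivAt (fun x : ℝ => (x : ℂ)) 1 x := Complex.ofRealCLM.hasDerivAt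
    have h2 := (hφ.smooth.differentiable (by simp) x).hasDerivAt
    rw [(h1.fun_mul h2).deriv, one_mul]
  have hw := hv _ hφ.mul_id
  have e1 : ∫ x in Omega, u x * deriv (fun x : ℝ => (x : ℂ) * φ x) x =
      (∫ x in Omega, u x * φ x) + ∫ x in Omega, position u x * deriv φ x := by
    rw [← integral_add (integrable_mul_test u hφ) (integrable_mul_test _ hφ.deriv)]
    refine integral_congr_ae ?_
    filter_upwards [coeFn_position u] with x hx
    rw [hd, hx]; ring
  have e2 : ∫ x in Omega, (u + position v : L2) x * φ x =
      (∫ x in Omega, u x * φ x) + ∫ x in Omega, v x * ((x : ℂ) * φ x) := by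
    rw [← integral_add (integrable_mul_test u hφ) (integrable_mul_test v hφ.mul_id)]
    refine integral_congr_ae ?_
    filter_upwards [coeFn_position v, Lp.coeFn_add u (position v)] with x hx h2
    rw [h2, Pi.add_apply, hx]; ring
  rw [e1] at hw
  rw [e2, neg_add, ← hw]; ring

/-- The symmetrized product `x ∘ p = (x p + p x) / 2` on `H¹(Ω)`. -/
def symmXP : H1 →ₗ[ℂ] L2 :=
  (1 / 2 : ℂ) • (position ∘ₗ momentum + momentum ∘ₗ position.restrict fun _ => position_mem_H1)

/-- The operator `l⁻² Δ_Dir - (l' / l) x ∘ p - (d' / l) p` with domain `H¹₀(Ω) ∩ H²(Ω)`, for given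
real numbers `l`, `l'`, `d'`. -/
def transformedOp (l l' d' : ℝ) : L2 →ₗ.[ℂ] L2 where
  domain := DDir
  toFun := ((1 / l ^ 2 : ℝ) : ℂ) • laplacianDir
    - ((l' / l : ℝ) : ℂ) • (symmXP ∘ₗ Submodule.inclusion DDir_le_H1)
    - ((d' / l : ℝ) : ℂ) • (momentum ∘ₗ Submodule.inclusion DDir_le_H1)

/-- The transformed time-dependent Hamiltonian associated with the motion `ℓ`, `d` on the time
interval `I`; time derivatives are taken within `I` (one-sided at the end points). -/
def transformedHamiltonian (I : Set ℝ) (ℓ d : ℝ → ℝ) (t : ℝ) : L2 →ₗ.[ℂ] L2 :=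
  transformedOp (ℓ t) (derivWithin ℓ I t) (derivWithin d I t)

end UnitInterval

end

end MovingBox

/-! Completing the square turns the operator into `ℓ⁻² (p - A)² + W` with `A = (ℓ ℓ' x + ℓ d') / 2`
and `W = -A² / ℓ²`. It is thus the operator of the form `κ ⟪(∂ - iA)·, (∂ - iA)·⟫ + ⟪·, W ·⟫` on
`H¹₀`, where `κ = ℓ⁻²`. Since `A` and `W` are bounded, this form is coercive up to a multiple of the
`L²` norm. Lax–Milgram then yields a resolvent, and with it self-adjointness and the form domain
(`IsFormOperator`, `isFormOperator_transformedOp`). Dropping the square leaves the lower bound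
`-‖W‖`, which compactness makes uniform in time.

For the dynamics, `A` is the `x`-derivative of a phase `c₁ x² + c₂ x`. Multiplication by the
exponential of `i` times this phase preserves `H¹₀` and removes `A`, at the price of a bounded
potential containing `c₁'` and `c₂'`; this is where second derivatives of `ℓ` and first derivatives
of `d'` enter (`IsMagneticSolution.gauge`). What remains is `κ(t)` times the `H¹₀` inner product
plus a bounded multiplication operator.

The unbounded parts at different times are now multiples of one operator, so in the new time `∫ κ`
they are integrated by a single unitary group, built from the functional calculus of the bounded
operator `J J*`, with `J : H¹₀ → L²` the embedding (`exists_unitary_group`, `exists_isFormGroup`).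
In the interaction picture a linear differential equation with bounded, strongly continuous
coefficient is left. Solving it on `L²` gives the unitary propagator; solving it on `H¹₀` shows that
the form domain is invariant. A weak solution, tested against a dense set of smooth vectors,
satisfies the same equation in integrated form, which gives uniqueness (`exists_triple_evolution`).
-/

namespace MovingBox

/-! ### Differentiation of strongly continuous operator families and of weakly differentiable
curves. -/

section StrongCalculus

variable {E F : Type*} [NormedAddCommGroup E] [NormedSpace ℂ E]
  [NormedAddCommGroup F] [NormedSpace ℂ F]

/-- Applying a bounded, strongly continuous family of operators to a convergent family of vectors. -/
theorem tendsto_strong_apply {α : Type*} {l : Filter α} {T : α → E →L[ℂ] F} {T₀ : E →L[ℂ] F}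
    {u : α → E} {u₀ : E} {C : ℝ} (hC : ∀ r, ‖T r‖ ≤ C)
    (hT : Tendsto (fun r => T r u₀) l (𝓝 (T₀ u₀))) (hu : Tendsto u l (𝓝 u₀)) :
    Tendsto (fun r => T r (u r)) l (𝓝 (T₀ u₀)) := by
  have h1 : Tendsto (fun r => T r (u r - u₀)) l (𝓝 0) := by
    have h2 : Tendsto (fun r => C * ‖u r - u₀‖) l (𝓝 0) := by
      have := ((hu.sub_const u₀).norm).const_mul C
      simpa using this
    exact squeeze_zero_norm (fun r => (T r).le_of_opNorm_le (hC r) _) h2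
  have := h1.add hT
  simpa using this

theorem continuous_strong_apply {α : Type*} [TopologicalSpace α] {T : α → E →L[ℂ] F}
    {u : α → E} {C : ℝ} (hC : ∀ r, ‖T r‖ ≤ C) (hT : ∀ x, Continuous fun r => T r x)
    (hu : Continuous u) : Continuous fun r => T r (u r) :=
  continuous_iff_continuousAt.2 fun t =>
    tendsto_strong_apply hC (hT (u t)).continuousAt hu.continuousAt

/-- The product rule for a strongly continuous family of operators. -/
theorem hasDerivWithinAt_strong_apply {T : ℝ → E →L[ℂ] F} {u : ℝ → E} {u' : E} {v : F} {C : ℝ}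
    {s : Set ℝ} {t : ℝ} (hC : ∀ r, ‖T r‖ ≤ C) (hT : ∀ x, ContinuousWithinAt (fun r => T r x) s t)
    (hTu : HasDerivWithinAt (fun r => T r (u t)) v s t) (hu : HasDerivWithinAt u u' s t) :
    HasDerivWithinAt (fun r => T r (u r)) (v + T t u') s t := by
  rw [hasDerivWithinAt_iff_tendsto_slope] at *
  have h1 : Tendsto (fun r => T r (slope u t r)) (𝓝[s \ {t}] t) (𝓝 (T t u')) :=
    tendsto_strong_apply hC ((hT u').tendsto.mono_left (nhdsWithin_mono _ sdiff_subset)) hu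
  refine (hTu.add h1).congr fun r => ?_
  have h2 : T r (((r - t)⁻¹ : ℝ) • (u r - u t)) = ((r - t)⁻¹ : ℝ) • T r (u r - u t) :=
    (T r).map_smul_of_tower _ _
  simp only [slope, vsub_eq_sub, h2]
  rw [map_sub, ← smul_add]
  congr 1
  abel

theorem hasDerivAt_strong_apply {T : ℝ → E →L[ℂ] F} {u : ℝ → E} {u' : E} {v : F} {C : ℝ}
    {t : ℝ} (hC : ∀ r, ‖T r‖ ≤ C) (hT : ∀ x, Continuous fun r => T r x)
    (hTu : HasDerivAt (fun r => T r (u t)) v t) (hu : HasDerivAt u u' t) :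
    HasDerivAt (fun r => T r (u r)) (v + T t u') t := by
  rw [← hasDerivWithinAt_univ] at *
  exact hasDerivWithinAt_strong_apply hC (fun x => (hT x).continuousWithinAt) hTu hu

/-- Strong differentiability extends from a dense set of vectors. -/
theorem hasDerivAt_of_dense {T D : ℝ → E →L[ℂ] F} {C : ℝ} (hD : ∀ t, ‖D t‖ ≤ C)
    {d : Set E} (hd : Dense d) (h : ∀ x ∈ d, ∀ t, HasDerivAt (fun r => T r x) (D t x) t)
    (x : E) (t : ℝ) : HasDerivAt (fun r => T r x) (D t x) t := by
  obtain ⟨y, hy, hyx⟩ := mem_closure_iff_seq_limit.1 (hd x)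
  have hunif : TendstoUniformly (fun n r => D r (y n)) (fun r => D r x) atTop := by
    rw [Metric.tendstoUniformly_iff]
    intro ε hε
    have h0 : Tendsto (fun n => C * ‖x - y n‖) atTop (𝓝 0) := by
      simpa using ((hyx.const_sub x).norm).const_mul C
    filter_upwards [h0.eventually (gt_mem_nhds hε)] with n hn r
    rw [dist_eq_norm, ← map_sub]
    exact ((D r).le_of_opNorm_le (hD r) _).trans_lt hn
  exact hasDerivAt_of_tendstoUniformly hunif (Eventually.of_forall fun n r => h _ (hy n) r)
    (fun r => ((T r).continuous.tendsto x).comp hyx) t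

theorem hasDerivAt_clm_apply (L : E →L[ℂ] F) {u : ℝ → E} {u' : E} {t : ℝ}
    (hu : HasDerivAt u u' t) : HasDerivAt (fun r => L (u r)) (L u') t :=
  (L.restrictScalars ℝ).hasFDerivAt.comp_hasDerivAt t hu

end StrongCalculus

section InnerCalculus

variable {E : Type*} [NormedAddCommGroup E] [InnerProductSpace ℂ E]

/-- The product rule for the inner product of a differentiable curve `v` and a continuous curve `w`
that is differentiable when tested against `v t`. -/
theorem hasDerivWithinAt_inner_of_weak {v w : ℝ → E} {v' : E} {z : ℂ} {s : Set ℝ} {t : ℝ}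
    (hv : HasDerivWithinAt v v' s t) (hw : ContinuousWithinAt w s t)
    (hvw : HasDerivWithinAt (fun r => ⟪v t, w r⟫_ℂ) z s t) :
    HasDerivWithinAt (fun r => ⟪v r, w r⟫_ℂ) (⟪v', w t⟫_ℂ + z) s t := by
  rw [hasDerivWithinAt_iff_tendsto_slope] at *
  have h1 : Tendsto (fun r => ⟪slope v t r, w r⟫_ℂ) (𝓝[s \ {t}] t) (𝓝 ⟪v', w t⟫_ℂ) :=
    hv.inner (hw.tendsto.mono_left (nhdsWithin_mono _ sdiff_subset))
  refine (h1.add hvw).congr fun r => ?_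
  simp only [slope, vsub_eq_sub, inner_smul_left_eq_smul, inner_sub_left, smul_sub]
  abel

end InnerCalculus

/-! ### Linear differential equations with bounded, strongly continuous coefficient. -/

section LinearODE

variable {F : Type*} [NormedAddCommGroup F] [NormedSpace ℂ F]

theorem linear_ode_unique {B : ℝ → F →L[ℂ] F} {C : ℝ} (hC : ∀ t, ‖B t‖ ≤ C) {u v : ℝ → F}
    (hu : ∀ t, HasDerivAt u (B t (u t)) t) (hv : ∀ t, HasDerivAt v (B t (v t)) t) {s : ℝ}
    (h : u s = v s) : u = v := by
  refine ODE_solution_unique_univ (v := fun t x => B t x) (s := fun _ => univ) (K := C.toNNReal)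
    (fun t => ?_) (fun t => ⟨hu t, mem_univ _⟩) (fun t => ⟨hv t, mem_univ _⟩) h
  refine ((B t).lipschitz.weaken ?_).lipschitzOnWith
  rw [← NNReal.coe_le_coe, coe_nnnorm]
  exact (hC t).trans (Real.le_coe_toNNReal C)

/-- Global solvability of linear ordinary differential equations with a bounded, strongly
continuous coefficient. -/
theorem exists_linear_ode [CompleteSpace F] {B : ℝ → F →L[ℂ] F} {C : ℝ} (hC : ∀ t, ‖B t‖ ≤ C)
    (hB : ∀ x, Continuous fun t => B t x) (s : ℝ) (x : F) :
    ∃ u : ℝ → F, u s = x ∧ ∀ t, HasDerivAt u (B t (u t)) t := by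
  have hC0 : 0 ≤ C := (norm_nonneg _).trans (hC 0)
  -- The unknown is sought as `w • v` with `v` bounded and `w` growing like `exp (k |t - s|)`. In
  -- this weighted norm the Picard map contracts on all of `ℝ` with factor `C / k ≤ 1 / 2`; the `+
  -- 1` keeps `k` positive when `C = 0`.
  set k : ℝ := 2 * (C + 1) with hk
  have hk0 : 0 < k := by positivity
  let w : ℝ → ℝ := fun t => Real.cosh (k * (t - s))
  have hw1 : ∀ t, 1 ≤ w t := fun t => Real.one_le_cosh _
  have hw0 : ∀ t, 0 < w t := fun t => Real.cosh_pos _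
  have hwc : Continuous w := Real.continuous_cosh.comp (by fun_prop)
  have hint : ∀ (g : ℝ → F) (K : ℝ), (∀ t, ‖g t‖ ≤ K * w t) → ∀ t,
      ‖∫ r in s..t, g r‖ ≤ K / k * w t := by
    intro g K hg t
    have hK : 0 ≤ K := nonneg_of_mul_nonneg_left ((norm_nonneg _).trans (hg 0)) (hw0 0)
    have h1 : ∫ r in s..t, K * w r = K * (Real.sinh (k * (t - s)) / k) := by
      have hd : ∀ r ∈ uIcc s t, HasDerivAt (fun r => K * (Real.sinh (k * (r - s)) / k))
          (K * w r) r := by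
        intro r _
        have := ((((hasDerivAt_id r).sub_const s).const_mul k).sinh.div_const k).const_mul K
        refine this.congr_deriv ?_
        simp only [w, id]
        field_simp
      rw [intervalIntegral.integral_eq_sub_of_hasDerivAt hd
        ((hwc.const_mul K).intervalIntegrable _ _)]
      simp
    refine (intervalIntegral.norm_integral_le_abs_of_norm_le
      (Eventually.of_forall fun r => hg r) ((hwc.const_mul K).intervalIntegrable _ _)).trans ?_
    rw [h1, abs_mul, abs_of_nonneg hK, abs_div, abs_of_pos hk0, div_mul_eq_mul_div, mul_div_assoc]
    gcongr
    rw [Real.abs_sinh]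
    exact (Real.sinh_lt_cosh _).le.trans (Real.cosh_abs _).le
  have hBc : ∀ v : ℝ → F, Continuous v → Continuous fun r => B r (w r • v r) :=
    fun v hv => continuous_strong_apply hC hB (hwc.smul hv)
  let Φ : BoundedContinuousFunction ℝ F → BoundedContinuousFunction ℝ F := fun v =>
    BoundedContinuousFunction.ofNormedAddCommGroup
      (fun t => (w t)⁻¹ • (x + ∫ r in s..t, B r (w r • v r)))
      ((hwc.inv₀ fun t => (hw0 t).ne').smul (continuous_const.add
        (intervalIntegral.continuous_primitive
          (fun a b => (hBc v v.continuous).intervalIntegrable a b) s)))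
      (‖x‖ + C * ‖v‖ / k) (by
        intro t
        have h2 := hint (fun r => B r (w r • v r)) (C * ‖v‖) (fun r => by
          refine ((B r).le_of_opNorm_le (hC r) _).trans ?_
          rw [norm_smul, Real.norm_eq_abs, abs_of_pos (hw0 r), mul_assoc]
          rw [mul_comm ‖v‖]
          exact mul_le_mul_of_nonneg_left
            (mul_le_mul_of_nonneg_left (v.norm_coe_le_norm r) (hw0 r).le) hC0) t
        rw [norm_smul, norm_inv, Real.norm_eq_abs, abs_of_pos (hw0 t), inv_mul_le_iff₀ (hw0 t)]
        refine (norm_add_le _ _).trans ?_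
        have h3 : ‖x‖ ≤ w t * ‖x‖ := le_mul_of_one_le_left (norm_nonneg _) (hw1 t)
        linarith [mul_comm (C * ‖v‖ / k) (w t)])
  have hΦ : ∀ v t, Φ v t = (w t)⁻¹ • (x + ∫ r in s..t, B r (w r • v r)) := fun _ _ => rfl
  have hcontr : ContractingWith (1 / 2) Φ := by
    refine ⟨by rw [← NNReal.coe_lt_coe]; norm_num, LipschitzWith.of_dist_le_mul fun v v' => ?_⟩
    rw [BoundedContinuousFunction.dist_le (by positivity)]
    intro t
    have h2 := hint (fun r => B r (w r • (v r - v' r))) (C * dist v v') (fun r => by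
      refine ((B r).le_of_opNorm_le (hC r) _).trans ?_
      rw [norm_smul, Real.norm_eq_abs, abs_of_pos (hw0 r), mul_assoc, mul_comm (dist v v')]
      refine mul_le_mul_of_nonneg_left (mul_le_mul_of_nonneg_left ?_ (hw0 r).le) hC0
      rw [← dist_eq_norm]
      exact BoundedContinuousFunction.dist_coe_le_dist r) t
    have h3 : ∫ r in s..t, B r (w r • (v r - v' r)) =
        (∫ r in s..t, B r (w r • v r)) - ∫ r in s..t, B r (w r • v' r) := by
      rw [← intervalIntegral.integral_sub ((hBc v v.continuous).intervalIntegrable _ _)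
        ((hBc v' v'.continuous).intervalIntegrable _ _)]
      simp only [smul_sub, map_sub]
    rw [hΦ, hΦ, dist_eq_norm, ← smul_sub, add_sub_add_left_eq_sub, ← h3, norm_smul, norm_inv,
      Real.norm_eq_abs, abs_of_pos (hw0 t), inv_mul_le_iff₀ (hw0 t)]
    refine h2.trans ?_
    rw [mul_comm (w t)]
    refine mul_le_mul_of_nonneg_right ?_ (hw0 t).le
    rw [div_le_iff₀ hk0]
    have : (((1 / 2 : NNReal)) : ℝ) = 1 / 2 := by norm_num
    rw [this, hk]
    nlinarith [dist_nonneg (x := v) (y := v')]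
  obtain ⟨v, hv⟩ : ∃ v, Φ v = v :=
    ⟨ContractingWith.fixedPoint Φ hcontr, hcontr.fixedPoint_isFixedPt⟩
  have hu : ∀ t, w t • v t = x + ∫ r in s..t, B r (w r • v r) := by
    intro t
    conv_lhs => rw [← hv]
    rw [hΦ, smul_inv_smul₀ (hw0 t).ne']
  refine ⟨fun t => w t • v t, ?_, fun t => ?_⟩
  · change w s • v s = x
    rw [hu, intervalIntegral.integral_same, add_zero]
  have h4 := (intervalIntegral.integral_hasDerivAt_right
    ((hBc v v.continuous).intervalIntegrable s t)
    ((hBc v v.continuous).stronglyMeasurableAtFilter _ _)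
    (hBc v v.continuous).continuousAt).const_add x
  exact h4.congr_of_eventuallyEq (Eventually.of_forall hu)

/-- Uniqueness on a compact interval for the integrated equation. -/
theorem linear_ode_unique_of_integral [CompleteSpace F] {B : ℝ → F →L[ℂ] F} {C : ℝ}
    (hC : ∀ t, ‖B t‖ ≤ C) (hB : ∀ x, Continuous fun t => B t x) {a b : ℝ} (hab : a ≤ b)
    {u v : ℝ → F} (hu : ∀ t, HasDerivAt u (B t (u t)) t) (hv : ContinuousOn v (Icc a b))
    (hva : v a = u a) (hvi : ∀ t ∈ Icc a b, v t = v a + ∫ r in a..t, B r (v r)) :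
    EqOn v u (Icc a b) := by
  -- Extending `v` by constants beyond the end points makes the primitive `z` two-sidedly
  -- differentiable on the whole interval, so that the uniqueness theorem applies to `z`.
  have hvc : Continuous (IccExtend hab ((Icc a b).domRestrict v)) :=
    (continuousOn_iff_continuous_domRestrict.1 hv).Icc_extend'
  set y := IccExtend hab ((Icc a b).domRestrict v) with hy
  have hyv : ∀ t ∈ Icc a b, y t = v t := fun t ht => IccExtend_of_mem hab _ ht
  have hByc : Continuous fun r => B r (y r) := continuous_strong_apply hC hB hvc
  set z : ℝ → F := fun t => v a + ∫ r in a..t, B r (y r) with hz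
  have hzv : ∀ t ∈ Icc a b, z t = v t := by
    intro t ht
    rw [hvi t ht, hz]
    refine congrArg (v a + ·) (intervalIntegral.integral_congr fun r hr => ?_)
    rw [uIcc_of_le ht.1] at hr
    simp only [hyv r ⟨hr.1, hr.2.trans ht.2⟩]
  have hzd : ∀ t ∈ Icc a b, HasDerivAt z (B t (z t)) t := by
    intro t ht
    have := (intervalIntegral.integral_hasDerivAt_right (hByc.intervalIntegrable a t)
      (hByc.stronglyMeasurableAtFilter _ _) hByc.continuousAt).const_add (v a)
    rwa [hyv t ht, ← hzv t ht] at this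
  have hlip : ∀ t ∈ Ico a b, LipschitzOnWith C.toNNReal (fun x => B t x) univ := by
    intro t _
    refine ((B t).lipschitz.weaken ?_).lipschitzOnWith
    rw [← NNReal.coe_le_coe, coe_nnnorm]
    exact (hC t).trans (Real.le_coe_toNNReal C)
  have := ODE_solution_unique_of_mem_Icc_right hlip
    (fun t ht => (hzd t ht).continuousAt.continuousWithinAt)
    (fun t ht => (hzd t (Ico_subset_Icc_self ht)).hasDerivWithinAt) (fun _ _ => mem_univ _)
    (fun t _ => (hu t).continuousAt.continuousWithinAt)
    (fun t _ => (hu t).hasDerivWithinAt) (fun _ _ => mem_univ _)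
    ((hzv a (left_mem_Icc.2 hab)).trans hva)
  exact fun t ht => (hzv t ht).symm.trans (this ht)

end LinearODE

/-! ### Dense ranges and extension of isometries. -/

section Density

variable {E F : Type*} [NormedAddCommGroup E] [InnerProductSpace ℂ E]
  [NormedAddCommGroup F] [InnerProductSpace ℂ F]

/-- The orthogonal complement of the range is the kernel of the adjoint. -/
theorem denseRange_of_adjoint_injective [CompleteSpace E] [CompleteSpace F] {T : E →L[ℂ] F}
    (h : Function.Injective (ContinuousLinearMap.adjoint T)) : DenseRange T := by
  have h1 : (LinearMap.range (T : E →ₗ[ℂ] F)).topologicalClosure = ⊤ := by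
    rw [Submodule.topologicalClosure_eq_top_iff, Submodule.eq_bot_iff]
    intro x hx
    refine h ?_
    rw [map_zero]
    refine ext_inner_left ℂ fun y => ?_
    rw [ContinuousLinearMap.adjoint_inner_right, inner_zero_right]
    exact (Submodule.mem_orthogonal _ _).1 hx _ (LinearMap.mem_range_self _ y)
  have := Submodule.dense_iff_topologicalClosure_eq_top.2 h1
  rwa [LinearMap.coe_range] at this

/-- If `‖Q x‖ = ‖P x‖` and `P` has dense range, then `Q` factors through `P` by an isometry. -/
theorem exists_isometry_comp_eq [CompleteSpace F] {X : Type*} [NormedAddCommGroup X] [NormedSpace ℂ X]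
    {P : X →L[ℂ] E} {Q : X →L[ℂ] F} (hP : DenseRange P) (h : ∀ x, ‖Q x‖ = ‖P x‖) :
    ∃ T : E →L[ℂ] F, (∀ x, T (P x) = Q x) ∧ ∀ y, ‖T y‖ = ‖y‖ := by
  have hTP := LinearMap.extendOfNorm_eq (f := (Q : X →ₗ[ℂ] F)) (e := (P : X →ₗ[ℂ] E)) hP
    ⟨1, fun x => by simp [h x]⟩
  refine ⟨(Q : X →ₗ[ℂ] F).extendOfNorm (P : X →ₗ[ℂ] E), hTP, fun y => ?_⟩
  refine hP.induction_on (p := fun y => ‖(Q : X →ₗ[ℂ] F).extendOfNorm (P : X →ₗ[ℂ] E) y‖ = ‖y‖) y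
    (isClosed_eq (by fun_prop) (by fun_prop)) fun x => ?_
  exact (congrArg norm (hTP x)).trans (h x)

theorem norm_le_one_of_isometry {T : E →L[ℂ] F} (h : ∀ x, ‖T x‖ = ‖x‖) : ‖T‖ ≤ 1 :=
  T.opNorm_le_bound zero_le_one fun x => by rw [h, one_mul]

/-- A family of contractions that is continuous on a dense range is strongly continuous. -/
theorem continuous_apply_of_dense {X : Type*} {T : ℝ → E →L[ℂ] F} (hT : ∀ t, ‖T t‖ ≤ 1)
    {P : X → E} (hP : DenseRange P) (h : ∀ x, Continuous fun t => T t (P x)) (y : E) :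
    Continuous fun t => T t y := by
  obtain ⟨z, hz, hzy⟩ := mem_closure_iff_seq_limit.1 (hP y)
  have hunif : TendstoUniformly (fun n r => T r (z n)) (fun r => T r y) atTop := by
    rw [Metric.tendstoUniformly_iff]
    intro ε hε
    have h0 : Tendsto (fun n => ‖y - z n‖) atTop (𝓝 0) := by
      simpa using (hzy.const_sub y).norm
    filter_upwards [h0.eventually (gt_mem_nhds hε)] with n hn r
    rw [dist_eq_norm, ← map_sub]
    exact ((T r).le_of_opNorm_le (hT r) _).trans_lt (by rwa [one_mul])
  refine hunif.continuous (Eventually.of_forall fun n => ?_).frequently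
  obtain ⟨x, hx⟩ := hz n
  rw [← hx]
  exact h x

end Density

/-! ### Scalar estimates for `r exp (-iτ/r)`. -/

section PhaseFunction

/-- The function `r ↦ r exp (-i τ / r)`, extended to `ℂ` through the real part. -/
noncomputable def phaseFun (τ : ℝ) (z : ℂ) : ℂ :=
  (z.re : ℂ) * Complex.exp (Complex.I * ((-τ * z.re⁻¹ : ℝ) : ℂ))

theorem norm_phaseFun (τ : ℝ) (z : ℂ) : ‖phaseFun τ z‖ = |z.re| := by
  rw [phaseFun, norm_mul, mul_comm Complex.I, Complex.norm_exp_ofReal_mul_I, mul_one,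
    Complex.norm_real, Real.norm_eq_abs]

/-- The oscillation of `exp (-iτ/r)` at `r = 0` is damped by the factor `r`, the modulus being
`|r|`. -/
theorem continuous_phaseFun (τ : ℝ) : Continuous (phaseFun τ) := by
  rw [continuous_iff_continuousAt]
  intro z
  by_cases hz : z.re = 0
  · have h0 : phaseFun τ z = 0 := by
      rw [← norm_eq_zero, norm_phaseFun, hz, abs_zero]
    rw [ContinuousAt, h0]
    refine squeeze_zero_norm (a := fun w : ℂ => |w.re|) (fun w => (norm_phaseFun τ w).le) ?_
    have : Continuous fun w : ℂ => |w.re| := by fun_prop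
    have h1 := this.tendsto z
    rwa [hz, abs_zero] at h1
  · unfold phaseFun
    have h2 : ContinuousAt (fun w : ℂ => w.re⁻¹) z :=
      Complex.continuous_re.continuousAt.inv₀ hz
    have h3 : ContinuousAt (fun w : ℂ => ((-τ * w.re⁻¹ : ℝ) : ℂ)) z :=
      Complex.continuous_ofReal.continuousAt.comp (h2.const_mul (-τ))
    exact (Complex.continuous_ofReal.comp Complex.continuous_re).continuousAt.mul
      (Complex.continuous_exp.continuousAt.comp (h3.const_mul Complex.I))

theorem phaseFun_zero (z : ℂ) : phaseFun 0 z = z.re := by simp [phaseFun]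

theorem phaseFun_mul (τ σ : ℝ) (z : ℂ) :
    phaseFun τ z * phaseFun σ z = phaseFun 0 z * phaseFun (τ + σ) z := by
  have : Complex.exp (Complex.I * ((-(τ + σ) * z.re⁻¹ : ℝ) : ℂ)) =
      Complex.exp (Complex.I * ((-τ * z.re⁻¹ : ℝ) : ℂ)) *
        Complex.exp (Complex.I * ((-σ * z.re⁻¹ : ℝ) : ℂ)) := by
    rw [← Complex.exp_add]; congr 1; push_cast; ring
  rw [phaseFun_zero]
  simp only [phaseFun, this]
  ring

theorem star_phaseFun_mul (τ : ℝ) (z : ℂ) :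
    star (phaseFun τ z) * phaseFun τ z = star (phaseFun 0 z) * phaseFun 0 z := by
  simp only [Complex.star_def, Complex.conj_mul', norm_phaseFun]

/-- For `|x| ≤ 1` this is the Taylor remainder; for larger `x` the crude bound `2|x|` is at most
`2x²`. -/
theorem norm_exp_I_sub_one_sub_le (x : ℝ) :
    ‖Complex.exp (Complex.I * x) - 1 - Complex.I * x‖ ≤ 2 * x ^ 2 := by
  have hx : ‖Complex.I * (x : ℂ)‖ = |x| := by simp
  rcases le_or_gt |x| 1 with h | h
  · have := Complex.norm_exp_sub_one_sub_id_le (hx.trans_le h)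
    rw [hx, sq_abs] at this
    nlinarith [sq_nonneg x]
  · have h1 := Real.norm_exp_I_mul_ofReal_sub_one_le (x := x)
    refine (norm_sub_le _ _).trans ?_
    rw [hx]
    rw [Real.norm_eq_abs] at h1
    rw [← sq_abs]
    nlinarith

/-- The prefactor `r` cancels the `1/r` in the phase difference, so the bound is uniform on the
spectrum. It gives norm continuity in `τ`. -/
theorem norm_phaseFun_sub_le (τ σ : ℝ) (z : ℂ) : ‖phaseFun τ z - phaseFun σ z‖ ≤ |τ - σ| := by
  by_cases hz : z.re = 0
  · have : ∀ τ, phaseFun τ z = 0 := fun τ => by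
      rw [← norm_eq_zero, norm_phaseFun, hz, abs_zero]
    rw [this, this, sub_zero, norm_zero]
    exact abs_nonneg _
  have h1 : phaseFun τ z - phaseFun σ z =
      phaseFun σ z * (Complex.exp (Complex.I * ((-(τ - σ) * z.re⁻¹ : ℝ) : ℂ)) - 1) := by
    rw [phaseFun, phaseFun, mul_sub, mul_one, mul_assoc, ← Complex.exp_add]
    congr 4; push_cast; ring
  rw [h1, norm_mul, norm_phaseFun]
  have h2 := Real.norm_exp_I_mul_ofReal_sub_one_le (x := -(τ - σ) * z.re⁻¹)
  rw [Real.norm_eq_abs, abs_mul, abs_neg, abs_inv] at h2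
  have hz' : 0 < |z.re| := abs_pos.2 hz
  calc _ ≤ |z.re| * (|τ - σ| * |z.re|⁻¹) := by gcongr
    _ = |τ - σ| := by field_simp

/-- The second-order remainder costs `1/r²`, which two factors `r` cancel. This is why the group is
differentiated on vectors of the form `G (G y)`. -/
theorem norm_phaseFun_taylor_le (τ σ : ℝ) (z : ℂ) :
    ‖(phaseFun τ z - phaseFun σ z) * phaseFun 0 z
      - ((-Complex.I * ((τ - σ : ℝ) : ℂ)) * phaseFun σ z)‖ ≤ 2 * (τ - σ) ^ 2 := by
  by_cases hz : z.re = 0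
  · have : ∀ τ, phaseFun τ z = 0 := fun τ => by
      rw [← norm_eq_zero, norm_phaseFun, hz, abs_zero]
    simp only [this, sub_zero, mul_zero, norm_zero]
    positivity
  have hz' : 0 < |z.re| := abs_pos.2 hz
  have h1 : phaseFun τ z =
      phaseFun σ z * Complex.exp (Complex.I * ((-(τ - σ) * z.re⁻¹ : ℝ) : ℂ)) := by
    rw [phaseFun, phaseFun, mul_assoc, ← Complex.exp_add]
    congr 3; push_cast; ring
  have hzc : (z.re : ℂ) ≠ 0 := Complex.ofReal_ne_zero.2 hz
  have h3 : (phaseFun τ z - phaseFun σ z) * phaseFun 0 z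
      - ((-Complex.I * ((τ - σ : ℝ) : ℂ)) * phaseFun σ z) = phaseFun σ z * z.re *
      (Complex.exp (Complex.I * ((-(τ - σ) * z.re⁻¹ : ℝ) : ℂ)) - 1
        - Complex.I * ((-(τ - σ) * z.re⁻¹ : ℝ) : ℂ)) := by
    have h4 : Complex.I * ((-(τ - σ) * z.re⁻¹ : ℝ) : ℂ) * z.re =
        -Complex.I * ((τ - σ : ℝ) : ℂ) := by
      push_cast
      field_simp
    rw [h1, phaseFun_zero, ← h4]
    ring
  rw [h3, norm_mul, norm_mul, norm_phaseFun, Complex.norm_real, Real.norm_eq_abs]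
  have h2 := norm_exp_I_sub_one_sub_le (-(τ - σ) * z.re⁻¹)
  calc _ ≤ |z.re| * |z.re| * (2 * (-(τ - σ) * z.re⁻¹) ^ 2) := by gcongr
    _ = 2 * (τ - σ) ^ 2 := by
      rw [abs_mul_abs_self]; field_simp

end PhaseFunction

/-! ### The unitary group generated by the inverse of a bounded operator. -/

section UnitaryGroup

variable {E : Type*} [NormedAddCommGroup E] [InnerProductSpace ℂ E] [CompleteSpace E]

/-- The unitary group generated by the inverse of an injective self-adjoint bounded operator. -/
theorem exists_unitary_group {G : E →L[ℂ] E} (hG : IsSelfAdjoint G)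
    (hinj : Function.Injective G) :
    ∃ S : ℝ → E →L[ℂ] E, (∀ τ x, ‖S τ x‖ = ‖x‖) ∧ S 0 = 1 ∧ (∀ τ σ, S (τ + σ) = S τ * S σ) ∧
      (∀ τ x, S τ (G x) = G (S τ x)) ∧ (∀ x, Continuous fun τ => S τ x) ∧
      ∀ y t, HasDerivAt (fun τ => S τ (G (G y))) (-Complex.I • S t (G y)) t := by
  have hdense : DenseRange G := denseRange_of_adjoint_injective (by
    rwa [← ContinuousLinearMap.star_eq_adjoint, hG.star_eq])
  have hnorm : IsStarNormal G := hG.isStarNormal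
  -- Formally `F τ = exp (-iτ G⁻¹) G`. The extra factor `G` makes the symbol continuous on the
  -- spectrum, so no calculus for unbounded operators is needed.
  let F : ℝ → E →L[ℂ] E := fun τ => cfc (phaseFun τ) G
  have hcont : ∀ τ, ContinuousOn (phaseFun τ) (spectrum ℂ G) :=
    fun τ => (continuous_phaseFun τ).continuousOn
  have hF0 : F 0 = G := by
    have h1 : cfc (phaseFun 0) G = cfc id G := cfc_congr fun z hz => by
      rw [phaseFun_zero, id]
      exact (hG.mem_spectrum_eq_re hz).symm
    exact h1.trans (cfc_id ℂ G)
  have hFmul : ∀ τ σ, F τ * F σ = G * F (τ + σ) := by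
    intro τ σ
    conv_rhs => rw [← hF0]
    simp only [F]
    rw [← cfc_mul _ _ G (hcont τ) (hcont σ), ← cfc_mul _ _ G (hcont 0) (hcont (τ + σ))]
    simp only [phaseFun_mul τ σ]
  have hFG : ∀ τ x, F τ (G x) = G (F τ x) := by
    intro τ x
    have h1 := hFmul τ 0
    rw [hF0, add_zero] at h1
    exact DFunLike.congr_fun h1 x
  have hFstar : ∀ τ, star (F τ) * F τ = star G * G := by
    intro τ
    conv_rhs => rw [← hF0]
    simp only [F]
    rw [← cfc_star, ← cfc_star, ← cfc_mul _ _ G (hcont τ).star (hcont τ),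
      ← cfc_mul _ _ G (hcont 0).star (hcont 0)]
    simp only [star_phaseFun_mul τ]
  have hnormsq : ∀ (T : E →L[ℂ] E) x, ((‖T x‖ ^ 2 : ℝ) : ℂ) = ⟪(star T * T) x, x⟫_ℂ := by
    intro T x
    rw [ContinuousLinearMap.star_eq_adjoint, mul_apply_eq_comp,
      ContinuousLinearMap.adjoint_inner_left, inner_self_eq_norm_sq_to_K]
    norm_cast
  have hFnorm : ∀ τ x, ‖F τ x‖ = ‖G x‖ := by
    intro τ x
    have h1 : ((‖F τ x‖ ^ 2 : ℝ) : ℂ) = ((‖G x‖ ^ 2 : ℝ) : ℂ) := by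
      rw [hnormsq, hnormsq, hFstar]
    exact (pow_left_inj₀ (norm_nonneg _) (norm_nonneg _) two_ne_zero).1 (Complex.ofReal_inj.1 h1)
  -- Since `F τ` and `G` have equal norms on every vector, the factor `G` can be divided out on its
  -- dense range.
  choose S hSF hSnorm using fun τ => exists_isometry_comp_eq hdense (hFnorm τ)
  have hext : ∀ {A B : E →L[ℂ] E}, (∀ x, A (G x) = B (G x)) → A = B := fun {A B} h =>
    ContinuousLinearMap.ext fun y => congrFun
      (hdense.equalizer A.continuous B.continuous (funext h)) y
  have hSG : ∀ τ x, S τ (G x) = G (S τ x) := by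
    intro τ x
    have : S τ * G = G * S τ := hext fun y => by
      simp only [mul_apply_eq_comp, hSF, hFG]
    exact DFunLike.congr_fun this x
  refine ⟨S, hSnorm, hext fun x => ?_, fun τ σ => hext fun x => hinj ?_, hSG, ?_, ?_⟩
  · rw [hSF, hF0, one_apply_eq_self]
  · rw [hSF, mul_apply_eq_comp, hSF, ← hSG, hSF]
    exact (DFunLike.congr_fun (hFmul τ σ) x).symm
  · refine continuous_apply_of_dense (fun τ => norm_le_one_of_isometry (hSnorm τ)) hdense
      fun x => ?_
    simp only [hSF]
    have hlip : LipschitzWith 1 F := LipschitzWith.of_dist_le_mul fun τ σ => by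
      rw [NNReal.coe_one, one_mul, dist_eq_norm, Real.dist_eq]
      simp only [F]
      rw [← cfc_sub _ _ G (hcont τ) (hcont σ)]
      exact norm_cfc_le (abs_nonneg _) fun z _ => norm_phaseFun_sub_le τ σ z
    exact hlip.continuous.clm_apply continuous_const
  · intro y t
    simp only [hSF]
    rw [hasDerivAt_iff_isLittleO]
    have hbound : ∀ τ, ‖F τ (G y) - F t (G y) - (τ - t) • (-Complex.I • F t y)‖ ≤
        2 * ‖y‖ * ‖‖τ - t‖ ^ 2‖ := by
      intro τ
      have h1 : cfc (fun z => (phaseFun τ z - phaseFun t z) * phaseFun 0 z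
          - ((-Complex.I * ((τ - t : ℝ) : ℂ)) * phaseFun t z)) G =
          (F τ - F t) * G - (-Complex.I * ((τ - t : ℝ) : ℂ)) • F t := by
        have hc1 : ContinuousOn (fun z => phaseFun τ z - phaseFun t z) (spectrum ℂ G) :=
          (hcont τ).sub (hcont t)
        have hc2 : ContinuousOn (fun z => (phaseFun τ z - phaseFun t z) * phaseFun 0 z)
            (spectrum ℂ G) := hc1.mul (hcont 0)
        have hc3 : ContinuousOn (fun z => (-Complex.I * ((τ - t : ℝ) : ℂ)) * phaseFun t z)
            (spectrum ℂ G) := continuousOn_const.mul (hcont t)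
        conv_rhs => enter [1, 2]; rw [← hF0]
        simp only [F]
        rw [cfc_sub _ _ G hc2 hc3, cfc_mul _ _ G hc1 (hcont 0),
          cfc_sub _ _ G (hcont τ) (hcont t), cfc_const_mul _ _ G (hcont t)]
      have h2 : ‖(F τ - F t) * G - (-Complex.I * ((τ - t : ℝ) : ℂ)) • F t‖ ≤ 2 * (τ - t) ^ 2 := by
        rw [← h1]
        exact norm_cfc_le (by positivity) fun z _ => norm_phaseFun_taylor_le τ t z
      have h3 := ContinuousLinearMap.le_of_opNorm_le _ h2 y
      rw [Real.norm_of_nonneg (sq_nonneg _), Real.norm_eq_abs, sq_abs]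
      refine le_of_eq_of_le ?_ (h3.trans_eq (by ring))
      congr 1
      simp only [sub_apply, mul_apply_eq_comp,
        smul_apply]
      rw [mul_comm, mul_smul]
      rfl
    refine (Asymptotics.IsBigO.of_bound (2 * ‖y‖) (Eventually.of_forall hbound)).trans_isLittleO ?_
    exact Asymptotics.isLittleO_pow_sub_sub t one_lt_two

end UnitaryGroup

/-! ### Unitary operators and propagators with bounded generators. -/

section Unitary

variable {E : Type*} [NormedAddCommGroup E] [InnerProductSpace ℂ E] [CompleteSpace E]

theorem mem_unitary_of_isometry_surjective {T : E →L[ℂ] E} (h : ∀ x, ‖T x‖ = ‖x‖)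
    (hs : Function.Surjective T) : T ∈ unitary (E →L[ℂ] E) := by
  have h1 : star T * T = 1 := T.norm_map_iff_adjoint_comp_self.1 h
  refine Unitary.mem_iff.2 ⟨h1, ContinuousLinearMap.ext fun y => ?_⟩
  obtain ⟨x, rfl⟩ := hs y
  have := DFunLike.congr_fun h1 x
  simp only [mul_apply_eq_comp, one_apply_eq_self] at *
  rw [this]

theorem unitary_star_apply {T : E →L[ℂ] E} (h : T ∈ unitary (E →L[ℂ] E)) (x : E) :
    star T (T x) = x := DFunLike.congr_fun (Unitary.mem_iff.1 h).1 x

theorem unitary_apply_star {T : E →L[ℂ] E} (h : T ∈ unitary (E →L[ℂ] E)) (x : E) :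
    T (star T x) = x := DFunLike.congr_fun (Unitary.mem_iff.1 h).2 x

theorem unitary_norm_apply {T : E →L[ℂ] E} (h : T ∈ unitary (E →L[ℂ] E)) (x : E) :
    ‖T x‖ = ‖x‖ := T.norm_map_iff_adjoint_comp_self.2 (Unitary.mem_iff.1 h).1 x

theorem inner_star_left (T : E →L[ℂ] E) (x y : E) : ⟪star T x, y⟫_ℂ = ⟪x, T y⟫_ℂ := by
  rw [ContinuousLinearMap.star_eq_adjoint, ContinuousLinearMap.adjoint_inner_left]

/-- The unitary propagator of a linear equation with a skew-symmetric, bounded, strongly continuous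
coefficient. -/
theorem exists_unitary_linear_ode {B : ℝ → E →L[ℂ] E} {C : ℝ} (hC : ∀ t, ‖B t‖ ≤ C)
    (hB : ∀ x, Continuous fun t => B t x) (hskew : ∀ t x, (⟪x, B t x⟫_ℂ).re = 0) :
    ∃ P : ℝ → E →L[ℂ] E, (∀ t, P t ∈ unitary (E →L[ℂ] E)) ∧
      ∀ x t, HasDerivAt (fun r => P r x) (B t (P t x)) t := by
  choose u hu0 hu using fun x => exists_linear_ode hC hB 0 x
  have huniq := fun {v w : ℝ → E} => linear_ode_unique hC (u := v) (v := w)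
  have hadd : ∀ x y, u (x + y) = u x + u y := fun x y =>
    huniq (hu _) (fun t => ((hu x t).add (hu y t)).congr_deriv (by simp)) (s := 0) (by simp [hu0])
  have hsmul : ∀ (c : ℂ) x, u (c • x) = c • u x := fun c x =>
    huniq (hu _) (fun t => ((hu x t).const_smul c).congr_deriv (by simp)) (s := 0) (by simp [hu0])
  have hnorm : ∀ x t, ‖u x t‖ = ‖x‖ := by
    intro x t
    have hd : ∀ t, HasDerivAt (fun r => ‖u x r‖ ^ 2) 0 t := by
      intro t
      have h1 := Complex.reCLM.hasFDerivAt.comp_hasDerivAt t ((hu x t).inner ℂ (hu x t))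
      have h2 : ∀ r, ‖u x r‖ ^ 2 = (⟪u x r, u x r⟫_ℂ).re := fun r =>
        (inner_self_eq_norm_sq (𝕜 := ℂ) (u x r)).symm
      simp only [h2]
      refine h1.congr_deriv ?_
      have h3 : (⟪B t (u x t), u x t⟫_ℂ).re = (⟪u x t, B t (u x t)⟫_ℂ).re :=
        inner_re_symm (𝕜 := ℂ) _ _
      rw [Complex.reCLM_apply, Complex.add_re, h3, hskew, add_zero]
    have h4 := is_const_of_deriv_eq_zero (fun t => (hd t).differentiableAt)
      (fun t => (hd t).deriv) t 0
    simp only [hu0] at h4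
    exact (pow_left_inj₀ (norm_nonneg _) (norm_nonneg _) two_ne_zero).1 h4
  let P : ℝ → E →L[ℂ] E := fun t => LinearMap.mkContinuous
    { toFun := fun x => u x t
      map_add' := fun x y => congrFun (hadd x y) t
      map_smul' := fun c x => congrFun (hsmul c x) t } 1
    (fun x => by simp [hnorm x t])
  have hP : ∀ t x, P t x = u x t := fun _ _ => rfl
  refine ⟨P, fun t => mem_unitary_of_isometry_surjective (hnorm · t) fun y => ?_, hu⟩
  -- Surjectivity at time `t`: the solution through `y` at time `t` is followed back to time `0`.
  obtain ⟨v, hv0, hv⟩ := exists_linear_ode hC hB t y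
  refine ⟨v 0, ?_⟩
  rw [hP, ← hv0]
  exact congrFun (huniq (hu _) hv (s := 0) (hu0 _)) t

end Unitary

/-! ### Evolution for a multiple of the form-space inner product plus a bounded operator. -/

section Triple

variable {E K : Type*} [NormedAddCommGroup E] [InnerProductSpace ℂ E] [CompleteSpace E]
  [NormedAddCommGroup K] [InnerProductSpace ℂ K] [CompleteSpace K]

open ContinuousLinearMap (adjoint)

/-- The unitary group on `E` generated by the operator of the inner product of `K`, where `K` is
embedded in `E` by `J`, together with its restriction to `K`. -/
structure IsFormGroup (J : K →L[ℂ] E) (S : ℝ → E →L[ℂ] E) (SK : ℝ → K →L[ℂ] K) : Prop where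
  norm_eq : ∀ τ x, ‖S τ x‖ = ‖x‖
  zero : S 0 = 1
  add : ∀ τ σ, S (τ + σ) = S τ * S σ
  comm : ∀ τ x, S τ (J (adjoint J x)) = J (adjoint J (S τ x))
  continuous : ∀ x, Continuous fun τ => S τ x
  normK_eq : ∀ τ k, ‖SK τ k‖ = ‖k‖
  restrict : ∀ τ k, J (SK τ k) = S τ (J k)
  continuousK : ∀ k, Continuous fun τ => SK τ k
  hasDerivAt : ∀ y t, HasDerivAt (fun τ => S τ (J (adjoint J (J (adjoint J y)))))
    (-Complex.I • S t (J (adjoint J y))) t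
  hasDerivAtK : ∀ k t, HasDerivAt (fun τ => adjoint J (S τ (J k))) (-Complex.I • SK t k) t

theorem adjoint_injective_of_denseRange {J : K →L[ℂ] E} (hJ : DenseRange J) :
    Function.Injective (adjoint J) := by
  refine (injective_iff_map_eq_zero _).2 fun x hx => ?_
  refine hJ.eq_zero_of_inner_left ℂ fun k => ?_
  rw [← ContinuousLinearMap.adjoint_inner_left, hx, inner_zero_left]

/-- `⟪J J* x, x⟫ = ‖J* x‖²`, and `J*` is injective because `J` has dense range. -/
theorem gram_injective {J : K →L[ℂ] E} (hJ : DenseRange J) :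
    Function.Injective (J ∘L adjoint J) := by
  refine (injective_iff_map_eq_zero _).2 fun x hx => ?_
  refine (map_eq_zero_iff _ (adjoint_injective_of_denseRange hJ)).1 ?_
  rw [← inner_self_eq_zero (𝕜 := ℂ), ContinuousLinearMap.adjoint_inner_left]
  rw [ContinuousLinearMap.comp_apply] at hx
  rw [hx, inner_zero_right]

theorem gram_isSelfAdjoint (J : K →L[ℂ] E) : IsSelfAdjoint (J ∘L adjoint J) := by
  rw [IsSelfAdjoint, ContinuousLinearMap.star_eq_adjoint, ContinuousLinearMap.adjoint_comp,
    ContinuousLinearMap.adjoint_adjoint]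

theorem gram_denseRange {J : K →L[ℂ] E} (hJ : DenseRange J) : DenseRange (J ∘L adjoint J) :=
  denseRange_of_adjoint_injective (by
    rw [← ContinuousLinearMap.star_eq_adjoint, (gram_isSelfAdjoint J).star_eq]
    exact gram_injective hJ)

/-- `J J*` is the inverse of the operator that the inner product of `K` defines in `E`. A unitary
commuting with it preserves `⟪J J* x, x⟫ = ‖J* x‖²`, so it descends along `J*` to an isometry of
`K`. -/
theorem exists_isFormGroup {J : K →L[ℂ] E} (hinj : Function.Injective J) (hJ : DenseRange J) :
    ∃ S SK, IsFormGroup J S SK := by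
  obtain ⟨S, hnorm, h0, hadd, hcomm, hcont, hder⟩ :=
    exists_unitary_group (gram_isSelfAdjoint J) (gram_injective hJ)
  simp only [ContinuousLinearMap.comp_apply] at hcomm hder
  have hJ' : DenseRange (adjoint J) := denseRange_of_adjoint_injective (by
    rwa [ContinuousLinearMap.adjoint_adjoint])
  have hinner : ∀ τ x y, ⟪S τ x, S τ y⟫_ℂ = ⟪x, y⟫_ℂ := fun τ x y => by
    rw [← inner_star_left, unitary_star_apply]
    refine mem_unitary_of_isometry_surjective (hnorm τ) fun z => ⟨S (-τ) z, ?_⟩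
    rw [← mul_apply_eq_comp, ← hadd, add_neg_cancel, h0, one_apply_eq_self]
  have hJS : ∀ τ x, ‖(adjoint J ∘L S τ) x‖ = ‖adjoint J x‖ := by
    intro τ x
    have h1 : ∀ z, ⟪J (adjoint J z), z⟫_ℂ = (‖adjoint J z‖ ^ 2 : ℝ) := fun z => by
      rw [← ContinuousLinearMap.adjoint_inner_right, inner_self_eq_norm_sq_to_K]
      norm_cast
    have h2 := h1 (S τ x)
    rw [← hcomm, hinner, h1, Complex.ofReal_inj] at h2
    exact ((pow_left_inj₀ (norm_nonneg _) (norm_nonneg _) two_ne_zero).1 h2).symm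
  choose SK hSK hSKn using fun τ => exists_isometry_comp_eq hJ' (hJS τ)
  simp only [ContinuousLinearMap.comp_apply] at hSK
  have hcontK : ∀ k, Continuous fun τ => SK τ k :=
    continuous_apply_of_dense (fun τ => norm_le_one_of_isometry (hSKn τ)) hJ' fun x => by
      simp only [hSK]
      exact (adjoint J).continuous.comp (hcont x)
  have hrestr : ∀ τ k, J (SK τ k) = S τ (J k) := fun τ k => congrFun
    (hJ'.equalizer (J ∘L SK τ).continuous (S τ ∘L J).continuous (funext fun x => by
      simp only [Function.comp_apply, ContinuousLinearMap.comp_apply, hSK, hcomm])) k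
  refine ⟨S, SK, hnorm, h0, hadd, hcomm, hcont, hSKn, hrestr, hcontK, hder, ?_⟩
  -- On these vectors the derivative comes from that of the group on `E`. It extends to all of `K`
  -- because the operators `-i SK` are uniformly bounded.
  have hdense : DenseRange fun y => adjoint J (J (adjoint J y)) :=
    hJ'.comp (gram_denseRange hJ) (adjoint J).continuous
  intro k t
  refine hasDerivAt_of_dense (T := fun τ => adjoint J ∘L S τ ∘L J)
    (D := fun τ => -Complex.I • SK τ) (C := 1) (fun τ => ?_) hdense ?_ k t
  · rw [norm_smul, norm_neg, Complex.norm_I, one_mul]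
    exact norm_le_one_of_isometry (hSKn τ)
  · rintro _ ⟨y, rfl⟩ t
    have h3 := hasDerivAt_clm_apply (adjoint J) (hder y t)
    simp only [ContinuousLinearMap.comp_apply, smul_apply, hSK]
    rw [map_smul] at h3
    exact h3

/-- The curve `ψ` solves, at time `t`, the weak Schrödinger equation with the form
`κ t ⟪·, ·⟫_K + ⟪·, W t ·⟫`. -/
def IsTripleSolution (J : K →L[ℂ] E) (κ : ℝ → ℝ) (W : ℝ → E →L[ℂ] E) (I : Set ℝ) (ψ : ℝ → E)
    (t : ℝ) : Prop :=
  ∃ k, J k = ψ t ∧ ∀ Φ, HasDerivWithinAt (fun r => ⟪J Φ, ψ r⟫_ℂ)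
    (-Complex.I * (κ t * ⟪Φ, k⟫_ℂ + ⟪J Φ, W t (ψ t)⟫_ℂ)) I t

namespace IsFormGroup

variable {J : K →L[ℂ] E} {S : ℝ → E →L[ℂ] E} {SK : ℝ → K →L[ℂ] K}

theorem neg_apply (h : IsFormGroup J S SK) (τ : ℝ) (x : E) : S (-τ) (S τ x) = x := by
  rw [← mul_apply_eq_comp, ← h.add, neg_add_cancel, h.zero, one_apply_eq_self]

theorem apply_neg (h : IsFormGroup J S SK) (τ : ℝ) (x : E) : S τ (S (-τ) x) = x := by
  rw [← mul_apply_eq_comp, ← h.add, add_neg_cancel, h.zero, one_apply_eq_self]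

theorem mem_unitary (h : IsFormGroup J S SK) (τ : ℝ) : S τ ∈ unitary (E →L[ℂ] E) :=
  mem_unitary_of_isometry_surjective (h.norm_eq τ) fun z => ⟨_, h.apply_neg τ z⟩

theorem star_eq (h : IsFormGroup J S SK) (τ : ℝ) : star (S τ) = S (-τ) :=
  ContinuousLinearMap.ext fun x => by
    rw [← h.apply_neg τ x, unitary_star_apply (h.mem_unitary τ), h.apply_neg]

theorem inner_left (h : IsFormGroup J S SK) (τ : ℝ) (x y : E) :
    ⟪S τ x, y⟫_ℂ = ⟪x, S (-τ) y⟫_ℂ := by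
  rw [← h.star_eq, ← inner_star_left, star_star]

theorem norm_le (h : IsFormGroup J S SK) (τ : ℝ) : ‖S τ‖ ≤ 1 := norm_le_one_of_isometry (h.norm_eq τ)

theorem normK_le (h : IsFormGroup J S SK) (τ : ℝ) : ‖SK τ‖ ≤ 1 :=
  norm_le_one_of_isometry (h.normK_eq τ)

end IsFormGroup

theorem norm_conj_le {F : Type*} [NormedAddCommGroup F] [NormedSpace ℂ F] {A B W : F →L[ℂ] F}
    {C : ℝ} (hA : ‖A‖ ≤ 1) (hB : ‖B‖ ≤ 1) (hW : ‖W‖ ≤ C) :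
    ‖-Complex.I • (A * W * B)‖ ≤ C := by
  rw [norm_smul, norm_neg, Complex.norm_I, one_mul]
  calc ‖A * W * B‖ ≤ ‖A‖ * ‖W‖ * ‖B‖ :=
        (norm_mul_le _ _).trans (mul_le_mul_of_nonneg_right (norm_mul_le _ _) (norm_nonneg _))
    _ ≤ 1 * C * 1 := by
      have := (norm_nonneg _).trans hW
      gcongr
    _ = C := by ring

/-- Well-posedness of the weak Schrödinger equation for the form `κ t ⟪·, ·⟫_K + ⟪·, W t ·⟫` with
bounded `W t` that restricts to a bounded operator on `K`. -/
theorem exists_triple_evolution {J : K →L[ℂ] E} (hinj : Function.Injective J) (hJ : DenseRange J)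
    {κ : ℝ → ℝ} (hκ : Continuous κ) {W : ℝ → E →L[ℂ] E} (hW : Continuous W)
    {C : ℝ} (hC : ∀ t, ‖W t‖ ≤ C) (hsa : ∀ t, IsSelfAdjoint (W t))
    {WK : ℝ → K →L[ℂ] K} (hWK : Continuous WK) {CK : ℝ} (hCK : ∀ t, ‖WK t‖ ≤ CK)
    (hJW : ∀ t k, J (WK t k) = W t (J k)) {a b : ℝ} (hab : a ≤ b) :
    ∃ Q : ℝ → E →L[ℂ] E, (∀ t, Q t ∈ unitary (E →L[ℂ] E)) ∧ (∀ x, Continuous fun t => Q t x) ∧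
      (∀ s k t, IsTripleSolution J κ W univ (fun r => Q r (star (Q s) (J k))) t) ∧
      ∀ ψ : ℝ → E, ContinuousOn ψ (Icc a b) →
        (∀ t ∈ Icc a b, IsTripleSolution J κ W (Icc a b) ψ t) →
        ∀ t ∈ Icc a b, ψ t = Q t (star (Q a) (ψ a)) := by
  obtain ⟨S, SK, h⟩ := exists_isFormGroup hinj hJ
  -- In the time `τ` the unbounded part of the form no longer depends on time.
  set τ : ℝ → ℝ := fun t => ∫ r in (0 : ℝ)..t, κ r
  have hτ : ∀ t, HasDerivAt τ (κ t) t := fun t => intervalIntegral.integral_hasDerivAt_right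
    (hκ.intervalIntegrable _ _) (hκ.stronglyMeasurableAtFilter _ _) hκ.continuousAt
  have hτc : Continuous τ := continuous_iff_continuousAt.2 fun t => (hτ t).continuousAt
  -- The interaction-picture generator, on `E` and, compatibly, on `K`.
  let B : ℝ → E →L[ℂ] E := fun t => -Complex.I • (S (-τ t) * W t * S (τ t))
  let BK : ℝ → K →L[ℂ] K := fun t => -Complex.I • (SK (-τ t) * WK t * SK (τ t))
  have hBapp : ∀ t x, B t x = -Complex.I • S (-τ t) (W t (S (τ t) x)) := fun _ _ => rfl
  have hBC : ∀ t, ‖B t‖ ≤ C := fun t => norm_conj_le (h.norm_le _) (h.norm_le _) (hC t)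
  have hBKC : ∀ t, ‖BK t‖ ≤ CK := fun t => norm_conj_le (h.normK_le _) (h.normK_le _) (hCK t)
  have hBc : ∀ x, Continuous fun t => B t x := fun x =>
    (continuous_strong_apply (T := fun t => S (-τ t)) (fun t => h.norm_le _)
      (fun x => (h.continuous x).comp hτc.neg)
      (hW.clm_apply ((h.continuous x).comp hτc))).const_smul (-Complex.I)
  have hBKc : ∀ x, Continuous fun t => BK t x := fun x =>
    (continuous_strong_apply (T := fun t => SK (-τ t)) (fun t => h.normK_le _)
      (fun x => (h.continuousK x).comp hτc.neg)
      (hWK.clm_apply ((h.continuousK x).comp hτc))).const_smul (-Complex.I)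
  have hskew : ∀ t x, (⟪x, B t x⟫_ℂ).re = 0 := by
    intro t x
    have h1 : (⟪S (τ t) x, W t (S (τ t) x)⟫_ℂ).im = 0 := by
      rw [← Complex.conj_eq_iff_im, inner_conj_symm, ← inner_star_left (W t), (hsa t).star_eq]
    rw [hBapp, inner_smul_right, ← h.inner_left]
    simp [h1]
  have hJB : ∀ t k, J (BK t k) = B t (J k) := by
    intro t k
    simp only [BK, B, smul_apply, mul_apply_eq_comp, map_smul, h.restrict, hJW]
  obtain ⟨P, hPu, hP⟩ := exists_unitary_linear_ode hBC hBc hskew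
  have hPsol : ∀ {u : ℝ → E}, (∀ t, HasDerivAt u (B t (u t)) t) → ∀ s t,
      u t = P t (star (P s) (u s)) := fun {u} hu s t =>
    congrFun (linear_ode_unique hBC hu (hP (star (P s) (u s))) (s := s)
      (unitary_apply_star (hPu s) _).symm) t
  have hPc : ∀ x, Continuous fun t => P t x := fun x =>
    continuous_iff_continuousAt.2 fun t => (hP x t).continuousAt
  have hQstar : ∀ t x, star (S (τ t) * P t) x = star (P t) (S (-τ t) x) := fun t x => by
    rw [star_mul, mul_apply_eq_comp, h.star_eq]
  refine ⟨fun t => S (τ t) * P t, fun t => mul_mem (h.mem_unitary _) (hPu t), fun x => ?_, ?_, ?_⟩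
  · exact continuous_strong_apply (T := fun t => S (τ t)) (fun t => h.norm_le _)
      (fun x => (h.continuous x).comp hτc) (hPc x)
  · intro s k t
    -- The equation is solved in `K`, so the solution stays in the form domain; uniqueness in `E`
    -- identifies its image with the orbit under `P`.
    obtain ⟨u, hus, hu⟩ := exists_linear_ode hBKC hBKc s (SK (-τ s) k)
    have hJu : ∀ r, J (u r) = P r (star (P s) (S (-τ s) (J k))) := by
      intro r
      have := hPsol (u := fun r => J (u r)) (fun t => by
        have := hasDerivAt_clm_apply J (hu t)
        rwa [hJB] at this) s r
      rwa [hus, h.restrict] at this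
    have hψ : ∀ r, (S (τ r) * P r) (star (S (τ s) * P s) (J k)) = S (τ r) (J (u r)) := by
      intro r
      rw [hQstar, mul_apply_eq_comp, hJu]
    simp only [hψ]
    have hd : HasDerivAt (fun r => adjoint J (S (τ r) (J (u r))))
        (κ t • (-Complex.I • SK (τ t) (u t)) + adjoint J (S (τ t) (J (BK t (u t))))) t := by
      refine hasDerivAt_strong_apply (T := fun r => adjoint J ∘L S (τ r) ∘L J)
        (C := ‖adjoint J‖ * ‖J‖) (fun r => ?_) (fun x => ?_) ?_ (hu t)
      · refine (ContinuousLinearMap.opNorm_comp_le _ _).trans ?_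
        refine mul_le_mul_of_nonneg_left ?_ (norm_nonneg _)
        refine (ContinuousLinearMap.opNorm_comp_le _ _).trans ?_
        exact mul_le_of_le_one_left (norm_nonneg _) (h.norm_le _)
      · exact (adjoint J).continuous.comp ((h.continuous (J x)).comp hτc)
      · exact (h.hasDerivAtK (u t) (τ t)).scomp t (hτ t)
    refine ⟨SK (τ t) (u t), h.restrict _ _, fun Φ => ?_⟩
    have hd2 := hasDerivAt_clm_apply (innerSL ℂ Φ) hd
    have hval : S (τ t) (J (BK t (u t))) = -Complex.I • W t (S (τ t) (J (u t))) := by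
      rw [hJB, hBapp, map_smul, h.apply_neg]
    rw [hval, map_smul, map_add] at hd2
    simp only [innerSL_apply_apply, ContinuousLinearMap.adjoint_inner_right,
      inner_smul_right, inner_smul_right_eq_smul] at hd2
    refine (hd2.congr_deriv ?_).hasDerivWithinAt
    rw [Complex.real_smul]
    ring
  · intro ψ hψc hψ
    set η : ℝ → E := fun t => S (-τ t) (ψ t) with hη
    have hηc : ContinuousOn η (Icc a b) := fun t ht =>
      tendsto_strong_apply (T := fun r => S (-τ r)) (T₀ := S (-τ t)) (fun t => h.norm_le _)
        (((h.continuous _).comp hτc.neg).continuousAt.mono_left nhdsWithin_le_nhds) (hψc t ht)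
    have hBηc : ContinuousOn (fun r => B r (η r)) (Icc a b) := fun t ht =>
      tendsto_strong_apply (T := B) (T₀ := B t) hBC
        ((hBc _).continuousAt.mono_left nhdsWithin_le_nhds) (hηc t ht)
    let G : E →L[ℂ] E := J ∘L adjoint J
    -- On `G (G y)` the group is differentiable in `E`, and its orbit lies in the range of `J`. The
    -- product rule therefore combines with the weak equation, and the two terms containing `κ`
    -- cancel.
    have hweak : ∀ y, ∀ t ∈ Icc a b, HasDerivWithinAt (fun r => ⟪G (G y), η r⟫_ℂ)
        ⟪G (G y), B t (η t)⟫_ℂ (Icc a b) t := by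
      intro y t ht
      have hinnerη : ∀ r, ⟪G (G y), η r⟫_ℂ = ⟪S (τ r) (G (G y)), ψ r⟫_ℂ := fun r =>
        (h.inner_left _ _ _).symm
      obtain ⟨k, hk, hΦ⟩ := hψ t ht
      have hv : HasDerivWithinAt (fun r => S (τ r) (G (G y))) (κ t • (-Complex.I • S (τ t) (G y)))
          (Icc a b) t := ((h.hasDerivAt y (τ t)).scomp t (hτ t)).hasDerivWithinAt
      have hSG : S (τ t) (G (G y)) = J (adjoint J (S (τ t) (G y))) := h.comm _ _
      have hw := hΦ (adjoint J (S (τ t) (G y)))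
      rw [← hSG] at hw
      have hd := hasDerivWithinAt_inner_of_weak hv (hψc t ht) hw
      simp only [hinnerη]
      refine hd.congr_deriv ?_
      have hB1 : ⟪G (G y), B t (η t)⟫_ℂ = -Complex.I * ⟪S (τ t) (G (G y)), W t (ψ t)⟫_ℂ := by
        rw [hBapp, inner_smul_right, ← h.inner_left, hη]
        simp only [h.apply_neg]
      rw [hB1, ContinuousLinearMap.adjoint_inner_left, hk, inner_smul_left_eq_smul,
        inner_smul_left, Complex.real_smul]
      simp only [map_neg, Complex.conj_I]
      ring
    have hint : ∀ t ∈ Icc a b, η t = η a + ∫ r in a..t, B r (η r) := by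
      intro t ht
      have hsub : Icc a t ⊆ Icc a b := Icc_subset_Icc_right ht.2
      have hii : IntervalIntegrable (fun r => B r (η r)) volume a t :=
        (hBηc.mono (by rwa [uIcc_of_le ht.1])).intervalIntegrable
      -- The vectors `G (G y)` are dense, so it suffices to integrate the weak equation against each
      -- of them.
      rw [← sub_eq_zero]
      refine ((gram_denseRange hJ).comp (gram_denseRange hJ)
        (J ∘L adjoint J).continuous).eq_zero_of_inner_right ℂ fun y => ?_
      have h1 := intervalIntegral.integral_eq_sub_of_hasDerivAt_of_le ht.1
        (f := fun r => ⟪G (G y), η r⟫_ℂ) (f' := fun r => ⟪G (G y), B r (η r)⟫_ℂ)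
        (fun r hr => ((hweak y r (hsub hr)).continuousWithinAt).mono hsub)
        (fun r hr => (hweak y r (hsub (Ioo_subset_Icc_self hr))).hasDerivAt
          (Icc_mem_nhds hr.1 (hr.2.trans_le ht.2)))
        (ContinuousOn.intervalIntegrable (by
          rw [uIcc_of_le ht.1]
          exact continuousOn_const.inner (hBηc.mono hsub)))
      have h2 := (innerSL ℂ (G (G y))).intervalIntegral_comp_comm hii
      simp only [innerSL_apply_apply] at h2
      rw [h2] at h1
      change ⟪G (G y), _⟫_ℂ = 0
      rw [inner_sub_right, inner_add_right, h1]
      ring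
    have hfin := linear_ode_unique_of_integral hBC hBc hab (hP (star (P a) (η a))) hηc
      (unitary_apply_star (hPu a) _).symm hint
    intro t ht
    have h3 : η t = P t (star (P a) (η a)) := hfin ht
    rw [hQstar, mul_apply_eq_comp]
    change ψ t = S (τ t) (P t (star (P a) (η a)))
    rw [← h3, hη]
    exact (h.apply_neg _ _).symm

end Triple

/-! ### Operators associated with closed semibounded forms. -/

section FormOperator

variable {E K : Type*} [NormedAddCommGroup E] [InnerProductSpace ℂ E] [CompleteSpace E]
  [NormedAddCommGroup K] [InnerProductSpace ℂ K] [CompleteSpace K]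

open ContinuousLinearMap (adjoint)

/-- `A` is the operator associated with the semibounded closed form `⟪k, T k⟫` on the form domain
`K`, embedded in `E` by `J`. -/
structure IsFormOperator (J : K →L[ℂ] E) (T : K →L[ℂ] K) (A : E →ₗ.[ℂ] E) : Prop where
  injective : Function.Injective J
  denseRange : DenseRange J
  isSelfAdjoint_form : IsSelfAdjoint T
  coercive : ∃ c > 0, ∃ μ : ℝ, ∀ k, c * ‖k‖ ^ 2 ≤ (⟪k, T k⟫_ℂ).re + μ * ‖J k‖ ^ 2
  mem_graph_iff : ∀ u f, (u, f) ∈ A.graph ↔ ∃ k, J k = u ∧ T k = adjoint J f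

namespace IsFormOperator

variable {J : K →L[ℂ] E} {T : K →L[ℂ] K} {A : E →ₗ.[ℂ] E}

theorem exists_lift (h : IsFormOperator J T A) (u : A.domain) :
    ∃ k, J k = u ∧ T k = adjoint J (A u) :=
  (h.mem_graph_iff _ _).1 (A.mem_graph u)

/-- The element of the form domain given by a vector of the operator domain. -/
noncomputable def lift (h : IsFormOperator J T A) (u : A.domain) : K := (h.exists_lift u).choose

theorem map_lift (h : IsFormOperator J T A) (u : A.domain) : J (h.lift u) = u :=
  (h.exists_lift u).choose_spec.1

theorem form_lift (h : IsFormOperator J T A) (u : A.domain) : T (h.lift u) = adjoint J (A u) :=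
  (h.exists_lift u).choose_spec.2

theorem lift_sub (h : IsFormOperator J T A) (u v : A.domain) :
    h.lift (u - v) = h.lift u - h.lift v := by
  refine h.injective ?_
  rw [map_sub, h.map_lift, h.map_lift, h.map_lift, Submodule.coe_sub]

theorem inner_apply (h : IsFormOperator J T A) (k : K) (v : A.domain) :
    ⟪J k, A v⟫_ℂ = ⟪k, T (h.lift v)⟫_ℂ := by
  rw [h.form_lift, ContinuousLinearMap.adjoint_inner_right]

/-- A shift of the operator is invertible; its inverse, as a map into the form domain. -/
theorem exists_resolvent (h : IsFormOperator J T A) :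
    ∃ μ : ℝ, ∃ R : E → K, DenseRange R ∧
      ∀ f, (J (R f), f - (μ : ℂ) • J (R f)) ∈ A.graph := by
  obtain ⟨c, hc, μ, hμ⟩ := h.coercive
  -- The shifted form is coercive on `K`, so Lax–Milgram inverts `Tμ`; the resolvent is `Tμ⁻¹ J*`.
  set Tμ : K →L[ℂ] K := T + (μ : ℂ) • (adjoint J ∘L J) with hTμ
  have hunit : IsUnit Tμ := by
    refine ContinuousLinearMap.isUnit_of_forall_le_norm_inner_map Tμ (c := c.toNNReal)
      (Real.toNNReal_pos.2 hc) fun k => ?_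
    have h1 : (⟪k, Tμ k⟫_ℂ).re = (⟪k, T k⟫_ℂ).re + μ * ‖J k‖ ^ 2 := by
      rw [hTμ, add_apply, inner_add_right, Complex.add_re, smul_apply,
        ContinuousLinearMap.comp_apply, inner_smul_right, ContinuousLinearMap.adjoint_inner_right,
        inner_self_eq_norm_sq_to_K, Complex.re_ofReal_mul]
      norm_cast
    rw [norm_inner_symm]
    refine le_trans ?_ (Complex.re_le_norm _)
    rw [h1, Real.coe_toNNReal c hc.le, mul_comm]
    exact hμ k
  obtain ⟨e, he⟩ := hunit
  have he1 : ∀ k, Tμ ((↑e⁻¹ : K →L[ℂ] K) k) = k := fun k => by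
    rw [← he, ← mul_apply_eq_comp, e.mul_inv, one_apply_eq_self]
  have he2 : ∀ k, (↑e⁻¹ : K →L[ℂ] K) (Tμ k) = k := fun k => by
    rw [← he, ← mul_apply_eq_comp, e.inv_mul, one_apply_eq_self]
  have hJ' : DenseRange (adjoint J) := denseRange_of_adjoint_injective (by
    rw [ContinuousLinearMap.adjoint_adjoint]; exact h.injective)
  refine ⟨μ, fun f => (↑e⁻¹ : K →L[ℂ] K) (adjoint J f), ?_, fun f => ?_⟩
  · have hs : Function.Surjective (↑e⁻¹ : K →L[ℂ] K) := fun k => ⟨_, he2 k⟩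
    exact hs.denseRange.comp hJ' (ContinuousLinearMap.continuous _)
  · refine (h.mem_graph_iff _ _).2 ⟨_, rfl, ?_⟩
    rw [map_sub, map_smul, eq_sub_iff_add_eq]
    exact he1 (adjoint J f)

/-- The resolvent maps into the operator domain and already has dense range in `K`: the operator
domain is a form core. -/
theorem dense_lift (h : IsFormOperator J T A) : DenseRange h.lift := by
  obtain ⟨μ, R, hR, hRA⟩ := h.exists_resolvent
  refine hR.mono ?_
  rintro _ ⟨f, rfl⟩
  obtain ⟨u, hu, -⟩ := LinearPMap.mem_graph_iff A |>.1 (hRA f)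
  exact ⟨u, h.injective ((h.map_lift u).trans hu)⟩

theorem dense_domain (h : IsFormOperator J T A) : Dense (A.domain : Set E) := by
  have := h.denseRange.comp h.dense_lift J.continuous
  refine Dense.mono ?_ this
  rintro _ ⟨u, rfl⟩
  rw [Function.comp_apply, h.map_lift]
  exact u.2

theorem isFormalAdjoint (h : IsFormOperator J T A) : A.IsFormalAdjoint A := fun u v => by
  rw [← h.map_lift v, ← h.map_lift u, h.inner_apply, ← inner_conj_symm, h.inner_apply,
    inner_conj_symm, ← inner_star_left, h.isSelfAdjoint_form.star_eq]

/-- A symmetric operator for which some `A + μ` with real `μ` is surjective is self-adjoint. For `v`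
in the domain of the adjoint, pick `u` with `(A + μ) u = (A* + μ) v`; then `v - u` is orthogonal to
the range of `A + μ`, so `v = u`. -/
theorem isSelfAdjoint (h : IsFormOperator J T A) : IsSelfAdjoint A := by
  suffices hle : A.adjoint ≤ A from
    le_antisymm hle (h.isFormalAdjoint.le_adjoint h.dense_domain)
  refine ⟨fun v hv => ?_, fun x y hxy => ?_⟩
  · obtain ⟨μ, R, hR, hRA⟩ := h.exists_resolvent
    set w := A.adjoint ⟨v, hv⟩
    obtain ⟨u, hu, hAu⟩ := LinearPMap.mem_graph_iff A |>.1 (hRA (w + (μ : ℂ) • v))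
    have hz : v - (u : E) = 0 := by
      rw [← inner_self_eq_zero (𝕜 := ℂ)]
      obtain ⟨u', hu', hAu'⟩ := LinearPMap.mem_graph_iff A |>.1 (hRA (v - (u : E)))
      have h1 := A.adjoint_isFormalAdjoint h.dense_domain ⟨v, hv⟩ u'
      have h2 := h.isFormalAdjoint u u'
      simp only at h1 h2 hu hAu hu' hAu'
      have h3 : v - (u : E) = A u' + (μ : ℂ) • (u' : E) := by
        rw [hAu', hu', sub_add_cancel]
      have h4 : w = A u + (μ : ℂ) • (u : E) - (μ : ℂ) • v := by
        rw [hAu, hu, sub_add_cancel, add_sub_cancel_right]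
      conv_lhs => enter [3]; rw [h3]
      have h5 : ⟪v, A u'⟫_ℂ = ⟪w, (u' : E)⟫_ℂ := h1.symm
      have h6 : ⟪(u : E), A u'⟫_ℂ = ⟪A u, (u' : E)⟫_ℂ := h2.symm
      rw [inner_add_right, inner_sub_left, inner_sub_left, h5, h6, h4, inner_smul_right,
        inner_smul_right, inner_sub_left, inner_add_left, inner_smul_left, inner_smul_left,
        Complex.conj_ofReal]
      ring
    rw [sub_eq_zero.1 hz]
    exact u.2
  · refine A.adjoint_apply_eq h.dense_domain x fun z => ?_
    have := h.isFormalAdjoint y z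
    rw [hxy]
    exact this

/-- By coercivity, a sequence that is Cauchy for the form and convergent in `E` is Cauchy in `K`;
the converse is continuity of `T` and `J`. The sequential form domain is thereby identified with
`K`. -/
theorem isFormApprox_iff (h : IsFormOperator J T A) (u : ℕ → A.domain) (Ψ : E) :
    IsFormApprox A u Ψ ↔ ∃ k, J k = Ψ ∧ Tendsto (fun n => h.lift (u n)) atTop (𝓝 k) := by
  constructor
  · rintro ⟨hu, hq⟩
    obtain ⟨c, hc, μ, hμ⟩ := h.coercive
    have hcauchy : CauchySeq fun n => h.lift (u n) := by
      rw [cauchySeq_iff_tendsto_dist_atTop_0]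
      have h1 : Tendsto (fun q : ℕ × ℕ => dist (u q.1 : E) (u q.2)) atTop (𝓝 0) :=
        cauchySeq_iff_tendsto_dist_atTop_0.1 hu.cauchySeq
      have h2 : Tendsto (fun q : ℕ × ℕ =>
          √(((⟪((u q.1 - u q.2 : A.domain) : E), A (u q.1 - u q.2)⟫_ℂ).re +
            μ * dist (u q.1 : E) (u q.2) ^ 2) / c)) atTop (𝓝 0) := by
        have h3 := (((Complex.continuous_re.tendsto _).comp hq).add
          ((h1.pow 2).const_mul μ)).div_const c
        have h4 := (Real.continuous_sqrt.tendsto _).comp h3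
        rw [Complex.zero_re, zero_pow two_ne_zero, mul_zero, add_zero, zero_div,
          Real.sqrt_zero] at h4
        exact h4
      refine squeeze_zero (fun _ => dist_nonneg) (fun q => ?_) h2
      refine Real.le_sqrt_of_sq_le ?_
      rw [le_div_iff₀ hc, mul_comm, dist_eq_norm, dist_eq_norm, ← h.lift_sub,
        ← Submodule.coe_sub, ← h.map_lift (u q.1 - u q.2), h.inner_apply]
      exact hμ _
    obtain ⟨k, hk⟩ := cauchySeq_tendsto_of_complete hcauchy
    refine ⟨k, tendsto_nhds_unique ((J.continuous.tendsto k).comp hk) ?_, hk⟩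
    simpa only [Function.comp_def, h.map_lift] using hu
  · rintro ⟨k, rfl, hk⟩
    refine ⟨by simpa only [Function.comp_def, h.map_lift] using (J.continuous.tendsto k).comp hk, ?_⟩
    have h1 : Tendsto (fun q : ℕ × ℕ => h.lift (u q.1) - h.lift (u q.2)) atTop (𝓝 (k - k)) := by
      rw [← prod_atTop_atTop_eq]
      exact (hk.comp tendsto_fst).sub (hk.comp tendsto_snd)
    have h2 := h1.inner (𝕜 := ℂ) ((T.continuous.tendsto _).comp h1)
    rw [sub_self, inner_zero_left] at h2
    refine h2.congr fun q => ?_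
    rw [← h.map_lift (u q.1 - u q.2), h.inner_apply, h.lift_sub, Function.comp_apply]

theorem formDomain_eq (h : IsFormOperator J T A) : formDomain A = range J := by
  ext Ψ
  simp only [formDomain, mem_ofPred_eq, h.isFormApprox_iff]
  constructor
  · rintro ⟨u, k, hk, -⟩
    exact ⟨k, hk⟩
  · rintro ⟨k, hk⟩
    obtain ⟨y, hy, hyk⟩ := mem_closure_iff_seq_limit.1 (h.dense_lift k)
    choose u hu using hy
    exact ⟨u, k, hk, by simpa only [hu] using hyk⟩

theorem hasFormValue (h : IsFormOperator J T A) (k k' : K) :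
    HasFormValue A (J k) (J k') ⟪k, T k'⟫_ℂ := by
  refine ⟨h.formDomain_eq ▸ mem_range_self k, h.formDomain_eq ▸ mem_range_self k',
    fun u v hu hv => ?_⟩
  obtain ⟨k₁, hk₁, hu'⟩ := (h.isFormApprox_iff _ _).1 hu
  obtain ⟨k₂, hk₂, hv'⟩ := (h.isFormApprox_iff _ _).1 hv
  rw [h.injective hk₁] at hu'
  rw [h.injective hk₂] at hv'
  refine (hu'.inner (𝕜 := ℂ) ((T.continuous.tendsto _).comp hv')).congr fun n => ?_
  rw [← h.map_lift (u n), h.inner_apply, Function.comp_apply]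

end IsFormOperator

end FormOperator

/-! ### One-parameter exponentials. -/

section ExpI

variable {E : Type*} [NormedAddCommGroup E] [InnerProductSpace ℂ E] [CompleteSpace E]

/-- The operator `exp (i c Y)`. -/
noncomputable def expI (Y : E →L[ℂ] E) (c : ℝ) : E →L[ℂ] E := NormedSpace.exp (c • (Complex.I • Y))

theorem hasDerivAt_expI (Y : E →L[ℂ] E) (x : E) (c : ℝ) :
    HasDerivAt (fun r => expI Y r x) (Complex.I • Y (expI Y c x)) c := by
  have h1 : HasDerivAt (expI Y) ((Complex.I • Y) * expI Y c) c :=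
    hasDerivAt_exp_smul_const' (𝕂 := ℝ) (Complex.I • Y) c
  exact (((ContinuousLinearMap.apply ℂ E) x).restrictScalars ℝ).hasFDerivAt.comp_hasDerivAt c h1

theorem expI_zero (Y : E →L[ℂ] E) : expI Y 0 = 1 := by
  rw [expI, zero_smul, NormedSpace.exp_zero]

theorem continuous_expI (Y : E →L[ℂ] E) : Continuous (expI Y) :=
  continuous_iff_continuousAt.2 fun c =>
    (hasDerivAt_exp_smul_const' (𝕂 := ℝ) (Complex.I • Y) c).continuousAt

theorem expI_commute {Y A : E →L[ℂ] E} (h : Commute A Y) (c : ℝ) : Commute A (expI Y c) := by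
  exact ((h.smul_right Complex.I).smul_right c).exp_right

theorem expI_mem_unitary {Y : E →L[ℂ] E} (hY : IsSelfAdjoint Y) (c : ℝ) :
    expI Y c ∈ unitary (E →L[ℂ] E) := by
  let : NormedAlgebra ℚ (E →L[ℂ] E) := .restrictScalars ℚ ℂ _
  refine NormedSpace.exp_mem_unitary_of_mem_skewAdjoint ?_
  rw [skewAdjoint.mem_iff, star_smul, star_smul, hY.star_eq, star_trivial, Complex.star_def,
    Complex.conj_I, neg_smul, smul_neg]

theorem expI_neg_apply (Y : E →L[ℂ] E) (c : ℝ) (x : E) : expI Y (-c) (expI Y c x) = x := by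
  let : NormedAlgebra ℚ (E →L[ℂ] E) := .restrictScalars ℚ ℂ _
  rw [← mul_apply_eq_comp, expI, expI,
    ← NormedSpace.exp_add_of_commute (by rw [neg_smul]; exact (Commute.refl _).neg_left), neg_smul,
    neg_add_cancel, NormedSpace.exp_zero, one_apply_eq_self]

theorem expI_apply_neg (Y : E →L[ℂ] E) (c : ℝ) (x : E) : expI Y c (expI Y (-c) x) = x := by
  simpa using expI_neg_apply Y (-c) x

theorem expI_inner_left {Y : E →L[ℂ] E} (hY : IsSelfAdjoint Y) (c : ℝ) (x y : E) :
    ⟪expI Y (-c) x, y⟫_ℂ = ⟪x, expI Y c y⟫_ℂ := by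
  have h : star (expI Y c) = expI Y (-c) := ContinuousLinearMap.ext fun z => by
    conv_lhs => rw [← expI_apply_neg Y c z]
    rw [unitary_star_apply (expI_mem_unitary hY c)]
  rw [← h, inner_star_left]

end ExpI

/-! ### Gauge transformations and magnetic forms. -/

section Gauge

variable {E K : Type*} [NormedAddCommGroup E] [InnerProductSpace ℂ E] [CompleteSpace E]
  [NormedAddCommGroup K] [InnerProductSpace ℂ K] [CompleteSpace K]

open ContinuousLinearMap (adjoint)

/-- The magnetic derivative `∂ - i A`. -/
noncomputable def covDeriv (J D : K →L[ℂ] E) (A : E →L[ℂ] E) : K →L[ℂ] E :=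
  D - Complex.I • (A ∘L J)

omit [CompleteSpace E] [CompleteSpace K] in
theorem covDeriv_apply (J D : K →L[ℂ] E) (A : E →L[ℂ] E) (k : K) :
    covDeriv J D A k = D k - Complex.I • A (J k) := rfl

/-- The operator `Y` preserves the domain of `D`, and `[D, Y] = Y'` commutes with `Y`. -/
structure IsGauge (J D : K →L[ℂ] E) (Y Y' : E →L[ℂ] E) (YK : K →L[ℂ] K) : Prop where
  isSelfAdjoint : IsSelfAdjoint Y
  commute : Commute Y' Y
  map_J : ∀ k, J (YK k) = Y (J k)
  map_D : ∀ k, D (YK k) = Y (D k) + Y' (J k)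

variable {J D : K →L[ℂ] E} {Y Y' : E →L[ℂ] E} {YK : K →L[ℂ] K}

/-- Both sides solve `f' = iY f` with the same value at `0`. -/
theorem IsGauge.map_expI (h : IsGauge J D Y Y' YK) (c : ℝ) (k : K) :
    J (expI YK c k) = expI Y c (J k) := by
  refine congrFun (linear_ode_unique (B := fun _ => Complex.I • Y) (C := ‖Complex.I • Y‖)
    (fun _ => le_rfl) (u := fun c => J (expI YK c k)) (fun t => ?_)
    (fun t => hasDerivAt_expI Y (J k) t) (s := 0) (by simp [expI_zero])) c
  have := hasDerivAt_clm_apply J (hasDerivAt_expI YK k t)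
  rwa [map_smul, h.map_J] at this

/-- Because the commutator `Y'` commutes with `Y`, the difference of the two sides solves `f' = iY
f` with `f(0) = 0`. -/
theorem IsGauge.map_D_expI (h : IsGauge J D Y Y' YK) (c : ℝ) (k : K) :
    D (expI YK c k) = expI Y c (D k) + c • (Complex.I • expI Y c (Y' (J k))) := by
  have hcomm : ∀ c x, Y' (expI Y c x) = expI Y c (Y' x) := fun c x =>
    DFunLike.congr_fun (expI_commute h.commute c) x
  rw [← sub_eq_zero]
  refine congrFun (linear_ode_unique (B := fun _ => Complex.I • Y) (C := ‖Complex.I • Y‖)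
    (fun _ => le_rfl)
    (u := fun c => D (expI YK c k) - (expI Y c (D k) + c • (Complex.I • expI Y c (Y' (J k)))))
    (v := fun _ => 0) (fun t => ?_) (fun t => by simpa using hasDerivAt_const t (0 : E)) (s := 0)
    (by simp [expI_zero])) c
  have h1 := hasDerivAt_clm_apply D (hasDerivAt_expI YK k t)
  rw [map_smul, h.map_D, h.map_expI, hcomm] at h1
  have h2 := (hasDerivAt_id t).smul ((hasDerivAt_expI Y (Y' (J k)) t).const_smul Complex.I)
  refine (h1.sub ((hasDerivAt_expI Y (D k) t).add h2)).congr_deriv ?_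
  have h3 : ∀ x : E, Y (t • x) = t • Y x := fun x => Y.map_smul_of_tower t x
  simp only [smul_apply, map_sub, map_add, map_smul, h3, id, smul_add, one_smul,
    Pi.smul_apply, smul_comm Complex.I t]
  abel

/-- Gauge covariance: the term `icY'` from differentiating the exponential is absorbed by the shift
of the potential. -/
theorem IsGauge.covDeriv_expI (h : IsGauge J D Y Y' YK) {A : E →L[ℂ] E} (hA : Commute A Y) (c : ℝ)
    (k : K) : covDeriv J D (A + (c : ℂ) • Y') (expI YK c k) = expI Y c (covDeriv J D A k) := by
  have hA' : ∀ x, A (expI Y c x) = expI Y c (A x) := fun x =>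
    DFunLike.congr_fun (expI_commute hA c) x
  have hY' : ∀ x, Y' (expI Y c x) = expI Y c (Y' x) := fun x =>
    DFunLike.congr_fun (expI_commute h.commute c) x
  rw [covDeriv_apply, covDeriv_apply, h.map_D_expI, h.map_expI, add_apply, smul_apply, hA', hY',
    map_sub, map_smul, smul_add, smul_comm Complex.I (c : ℂ), Complex.coe_smul]
  abel

/-- The curve `ψ` solves, at time `t`, the weak Schrödinger equation with the form
`κ ⟪(∂ - i A) ·, (∂ - i A) ·⟫ + ⟪·, W ·⟫`. -/
def IsMagneticSolution (J D : K →L[ℂ] E) (κ : ℝ) (A W : E →L[ℂ] E) (I : Set ℝ) (ψ : ℝ → E)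
    (t : ℝ) : Prop :=
  ∃ k, J k = ψ t ∧ ∀ Φ, HasDerivWithinAt (fun r => ⟪J Φ, ψ r⟫_ℂ)
    (-Complex.I * (κ * ⟪covDeriv J D A Φ, covDeriv J D A k⟫_ℂ + ⟪J Φ, W (ψ t)⟫_ℂ)) I t

/-- Gauge transformations map weak solutions to weak solutions. -/
theorem IsMagneticSolution.gauge {κ : ℝ} {A W : E →L[ℂ] E} {I : Set ℝ} {ψ : ℝ → E} {t : ℝ}
    (hψ : IsMagneticSolution J D κ A W I ψ t) (hψc : ContinuousWithinAt ψ I t)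
    (h : IsGauge J D Y Y' YK) (hA : Commute A Y) (hW : Commute W Y) {c : ℝ → ℝ} {c' : ℝ}
    (hc : HasDerivWithinAt c c' I t) :
    IsMagneticSolution J D κ (A + (c t : ℂ) • Y') (W - (c' : ℂ) • Y) I (fun r => expI Y (c r) (ψ r)) t := by
  obtain ⟨k, hk, hΦ⟩ := hψ
  refine ⟨expI YK (c t) k, by rw [h.map_expI, hk], fun Φ => ?_⟩
  -- The exponential is moved onto the test vector, where it is differentiable and stays in the
  -- range of `J`; its time derivative produces the term `-c' Y`.
  have hv : HasDerivWithinAt (fun r => expI Y (-c r) (J Φ))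
      (-c' • (Complex.I • Y (expI Y (-c t) (J Φ)))) I t :=
    HasDerivAt.scomp_hasDerivWithinAt (g₁ := fun r => expI Y r (J Φ)) (h := fun r => -c r) t
      (hasDerivAt_expI Y (J Φ) (-c t)) hc.neg
  have hw := hΦ (expI YK (-c t) Φ)
  rw [h.map_expI] at hw
  have hd := hasDerivWithinAt_inner_of_weak hv hψc hw
  simp only [expI_inner_left h.isSelfAdjoint] at hd
  refine hd.congr_deriv ?_
  have h1 : covDeriv J D A (expI YK (-c t) Φ) =
      expI Y (-c t) (covDeriv J D (A + (c t : ℂ) • Y') Φ) := by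
    rw [← h.covDeriv_expI (hA.add_left (h.commute.smul_left (c t : ℂ)))]
    congr 2
    push_cast
    module
  have hW' : ∀ x, W (expI Y (c t) x) = expI Y (c t) (W x) := fun x =>
    DFunLike.congr_fun (expI_commute hW _) x
  have hY' : ∀ x, Y (expI Y (c t) x) = expI Y (c t) (Y x) := fun x =>
    DFunLike.congr_fun (expI_commute (Commute.refl Y) _) x
  have h2 : ⟪Y (expI Y (-c t) (J Φ)), ψ t⟫_ℂ = ⟪J Φ, expI Y (c t) (Y (ψ t))⟫_ℂ := by
    rw [← expI_inner_left h.isSelfAdjoint, ← inner_star_left Y, h.isSelfAdjoint.star_eq]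
  rw [h1, expI_inner_left h.isSelfAdjoint, ← h.covDeriv_expI hA, inner_smul_left_eq_smul,
    inner_smul_left, h2, sub_apply, smul_apply, hW', hY', inner_sub_right,
    inner_smul_right, Complex.real_smul, Complex.conj_I]
  push_cast
  ring

/-- The operator on the form domain representing the form
`κ ⟪(∂ - i A) ·, (∂ - i A) ·⟫ + ⟪·, W ·⟫`. -/
noncomputable def magneticForm (J D : K →L[ℂ] E) (κ : ℝ) (A W : E →L[ℂ] E) : K →L[ℂ] K :=
  (κ : ℂ) • (adjoint (covDeriv J D A) ∘L covDeriv J D A) + adjoint J ∘L W ∘L J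

theorem inner_magneticForm (κ : ℝ) (A W : E →L[ℂ] E) (k k' : K) :
    ⟪k, magneticForm J D κ A W k'⟫_ℂ =
      κ * ⟪covDeriv J D A k, covDeriv J D A k'⟫_ℂ + ⟪J k, W (J k')⟫_ℂ := by
  rw [magneticForm, add_apply, inner_add_right, smul_apply, inner_smul_right,
    ContinuousLinearMap.comp_apply, ContinuousLinearMap.adjoint_inner_right,
    ContinuousLinearMap.comp_apply, ContinuousLinearMap.adjoint_inner_right,
    ContinuousLinearMap.comp_apply]

theorem magneticForm_isSelfAdjoint (κ : ℝ) (A : E →L[ℂ] E) {W : E →L[ℂ] E}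
    (hW : IsSelfAdjoint W) : IsSelfAdjoint (magneticForm J D κ A W) := by
  refine ContinuousLinearMap.ext fun k => ext_inner_left ℂ fun k' => ?_
  rw [← inner_conj_symm, inner_star_left, inner_magneticForm, inner_magneticForm, map_add, map_mul,
    inner_conj_symm, inner_conj_symm, Complex.conj_ofReal, ← inner_star_left, hW.star_eq]

omit [CompleteSpace E] in
theorem neg_norm_mul_sq_le_re_inner (W : E →L[ℂ] E) (x : E) :
    -(‖W‖ * ‖x‖ ^ 2) ≤ (⟪x, W x⟫_ℂ).re := by
  refine (neg_le_neg ?_).trans (neg_le_of_abs_le (Complex.abs_re_le_norm _))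
  refine (norm_inner_le_norm _ _).trans ?_
  have := W.le_opNorm x
  nlinarith [norm_nonneg x]

theorem magneticForm_coercive (hK : ∀ k, ‖k‖ ^ 2 = ‖J k‖ ^ 2 + ‖D k‖ ^ 2) {κ : ℝ} (hκ : 0 < κ)
    (A W : E →L[ℂ] E) : ∃ c > 0, ∃ μ : ℝ, ∀ k,
      c * ‖k‖ ^ 2 ≤ (⟪k, magneticForm J D κ A W k⟫_ℂ).re + μ * ‖J k‖ ^ 2 := by
  -- Half of `κ` is lost in `‖D k‖² ≤ 2 ‖(∂ - iA) k‖² + 2 ‖A‖² ‖J k‖²`; the remaining terms go into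
  -- the shift.
  refine ⟨κ / 2, half_pos hκ, κ / 2 + κ * ‖A‖ ^ 2 + ‖W‖, fun k => ?_⟩
  have h1 : ‖D k‖ ≤ ‖covDeriv J D A k‖ + ‖A‖ * ‖J k‖ := by
    have h2 : D k = covDeriv J D A k + Complex.I • A (J k) := by
      rw [covDeriv_apply, sub_add_cancel]
    calc ‖D k‖ ≤ ‖covDeriv J D A k‖ + ‖Complex.I • A (J k)‖ := by
          conv_lhs => rw [h2]
          exact norm_add_le _ _
      _ ≤ _ := by
          rw [norm_smul, Complex.norm_I, one_mul]
          gcongr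
          exact A.le_opNorm _
  have h3 := neg_norm_mul_sq_le_re_inner W (J k)
  have h4 : (⟪k, magneticForm J D κ A W k⟫_ℂ).re =
      κ * ‖covDeriv J D A k‖ ^ 2 + (⟪J k, W (J k)⟫_ℂ).re := by
    rw [inner_magneticForm, Complex.add_re, inner_self_eq_norm_sq_to_K, Complex.re_ofReal_mul]
    norm_cast
  have h5 : ‖D k‖ ^ 2 ≤ 2 * ‖covDeriv J D A k‖ ^ 2 + 2 * (‖A‖ * ‖J k‖) ^ 2 := by
    have := pow_le_pow_left₀ (norm_nonneg _) h1 2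
    nlinarith [sq_nonneg (‖covDeriv J D A k‖ - ‖A‖ * ‖J k‖)]
  rw [h4, hK]
  nlinarith

/-- The magnetic term is nonnegative. The bound involves `‖W‖` alone, which is what makes it uniform
in time later. -/
theorem neg_norm_le_re_inner_magneticForm {κ : ℝ} (hκ : 0 ≤ κ) (A W : E →L[ℂ] E) (k : K) :
    -‖W‖ * ‖J k‖ ^ 2 ≤ (⟪k, magneticForm J D κ A W k⟫_ℂ).re := by
  have h3 := neg_norm_mul_sq_le_re_inner W (J k)
  rw [inner_magneticForm, Complex.add_re, inner_self_eq_norm_sq_to_K, Complex.re_ofReal_mul]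
  have : 0 ≤ κ * ((((‖covDeriv J D A k‖ : ℝ) : ℂ)) ^ 2).re := by
    rw [← Complex.ofReal_pow, Complex.ofReal_re]
    positivity
  rw [neg_mul]
  exact h3.trans (le_add_of_nonneg_left this)

end Gauge

noncomputable section

open ContinuousLinearMap (adjoint)

/-! ### Weak derivatives tested in the inner product. -/

section TestFunctions

theorem deriv_conj (φ : ℝ → ℂ) (x : ℝ) :
    deriv (fun x => (starRingEnd ℂ) (φ x)) x = (starRingEnd ℂ) (deriv φ x) := by
  exact deriv.star

theorem IsTestFunction.conj {φ : ℝ → ℂ} (hφ : IsTestFunction φ) :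
    IsTestFunction (fun x => (starRingEnd ℂ) (φ x)) := by
  have hs : tsupport (fun x => (starRingEnd ℂ) (φ x)) = tsupport φ := by
    have : Function.support (fun x => (starRingEnd ℂ) (φ x)) = Function.support φ := by
      ext x; simp
    simp only [tsupport, this]
  refine ⟨Complex.conjCLE.contDiff.comp hφ.smooth, ?_, hs ▸ hφ.support_subset⟩
  unfold HasCompactSupport
  rw [hs]
  exact hφ.compact

theorem IsTestFunction.eq_zero_of_notMem {φ : ℝ → ℂ} (hφ : IsTestFunction φ) {x : ℝ}
    (hx : x ∉ Omega) : φ x = 0 := by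
  by_contra hne
  exact hx (hφ.support_subset (subset_tsupport φ hne))

theorem IsTestFunction.exists_testGraph {φ : ℝ → ℂ} (hφ : IsTestFunction φ) :
    ∃ q ∈ testGraph, q.1 =ᵐ[volume.restrict Omega] φ ∧
      q.2 =ᵐ[volume.restrict Omega] _root_.deriv φ :=
  ⟨(hφ.memLp.toLp φ, hφ.deriv.memLp.toLp _),
    ⟨φ, hφ, hφ.memLp.coeFn_toLp, hφ.deriv.memLp.coeFn_toLp⟩,
    hφ.memLp.coeFn_toLp, hφ.deriv.memLp.coeFn_toLp⟩

theorem inner_eq_integral_mul_conj {u w : L2} {φ : ℝ → ℂ} (h : u =ᵐ[volume.restrict Omega] φ) :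
    ⟪u, w⟫_ℂ = ∫ x in Omega, w x * (starRingEnd ℂ) (φ x) := by
  rw [L2.inner_def]
  refine integral_congr_ae ?_
  filter_upwards [h] with x hx
  rw [hx, RCLike.inner_apply]

/-- Test functions are stable under conjugation, so the bilinear pairing may be replaced by the
inner product. -/
theorem isWeakDeriv_iff_testGraph (w w' : L2) :
    IsWeakDeriv w w' ↔ ∀ q ∈ testGraph, ⟪q.1, w'⟫_ℂ = -⟪q.2, w⟫_ℂ := by
  constructor
  · rintro h q ⟨φ, hφ, h1, h2⟩
    have := h _ hφ.conj
    simp only [deriv_conj] at this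
    rw [inner_eq_integral_mul_conj h1, inner_eq_integral_mul_conj h2, this, neg_neg]
  · intro h φ hφ
    obtain ⟨q, hq, h1, h2⟩ := hφ.conj.exists_testGraph
    have := h q hq
    rw [inner_eq_integral_mul_conj h1, inner_eq_integral_mul_conj h2] at this
    simp only [deriv_conj, Complex.conj_conj] at this
    rw [this, neg_neg]

theorem testGraph_le_weakDerivGraph : testGraph ≤ weakDerivGraph := by
  rintro q ⟨φ, hφ, h1, h2⟩ ψ hψ
  have e1 : ∫ x in Omega, q.1 x * deriv ψ x = ∫ x in Omega, φ x * deriv ψ x :=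
    integral_congr_ae (h1.mono fun x hx => by simp only [hx])
  have e2 : ∫ x in Omega, q.2 x * ψ x = ∫ x in Omega, deriv φ x * ψ x :=
    integral_congr_ae (h2.mono fun x hx => by simp only [hx])
  have hint : ∀ {f g : ℝ → ℂ}, IsTestFunction f → IsTestFunction g → Integrable (f * g) :=
    fun {f g} hf hg => (hf.smooth.continuous.mul hg.smooth.continuous).integrable_of_hasCompactSupport
      hf.compact.mul_right
  have hd : ∀ {f : ℝ → ℂ}, IsTestFunction f → ∀ x, HasDerivAt f (deriv f x) x := fun {f} hf x =>
    (hf.smooth.differentiable (by simp) x).hasDerivAt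
  rw [e1, e2, setIntegral_eq_integral_of_forall_compl_eq_zero
      (fun x hx => by rw [hφ.eq_zero_of_notMem hx, zero_mul]),
    setIntegral_eq_integral_of_forall_compl_eq_zero
      (fun x hx => by rw [hψ.eq_zero_of_notMem hx, mul_zero])]
  exact integral_mul_deriv_eq_deriv_mul_of_integrable (fun x _ => hd hφ x)
    (fun x _ => hd hψ x) (hint hφ hψ.deriv)
    (hint hφ.deriv hψ) (hint hφ hψ)

end TestFunctions

/-! ### `H¹₀` as a Hilbert space embedded in `L²`. -/

section FormSpace

/-- The graph of the derivative on `H¹₀(Ω)`, as a subspace of the Hilbert sum `L²(Ω) ⊕ L²(Ω)`. -/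
def sobolevGraph : Submodule ℂ (WithLp 2 (L2 × L2)) :=
  (testGraph.comap (WithLp.linearEquiv 2 ℂ (L2 × L2) : WithLp 2 (L2 × L2) →ₗ[ℂ] L2 × L2)).topologicalClosure

/-- The Sobolev space `H¹₀(Ω)` with its Hilbert space structure. -/
abbrev FormSpace : Type := sobolevGraph

instance : CompleteSpace FormSpace :=
  (Submodule.isClosed_topologicalClosure _).completeSpace_coe

/-- The embedding of `H¹₀(Ω)` in `L²(Ω)`. -/
def embed : FormSpace →L[ℂ] L2 := WithLp.fstL 2 ℂ L2 L2 ∘L sobolevGraph.subtypeL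

/-- The derivative on `H¹₀(Ω)`. -/
def grad : FormSpace →L[ℂ] L2 := WithLp.sndL 2 ℂ L2 L2 ∘L sobolevGraph.subtypeL

theorem formSpace_inner (k k' : FormSpace) :
    ⟪k, k'⟫_ℂ = ⟪embed k, embed k'⟫_ℂ + ⟪grad k, grad k'⟫_ℂ :=
  WithLp.prod_inner_apply (k : WithLp 2 (L2 × L2)) k'

theorem formSpace_norm_sq (k : FormSpace) : ‖k‖ ^ 2 = ‖embed k‖ ^ 2 + ‖grad k‖ ^ 2 :=
  WithLp.prod_norm_sq_eq_of_L2 (k : WithLp 2 (L2 × L2))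

theorem formSpace_induction {p : L2 × L2 → Prop} (hp : IsClosed {q | p q})
    (h : ∀ q ∈ testGraph, p q) (k : FormSpace) : p (embed k, grad k) := by
  have h1 : IsClosed ((WithLp.prodContinuousLinearEquiv 2 ℂ L2 L2) ⁻¹' {q | p q}) :=
    hp.preimage (WithLp.prodContinuousLinearEquiv 2 ℂ L2 L2).continuous
  exact h1.closure_subset_iff.2 (fun x hx => h _ hx) k.2

theorem exists_formSpace_of_testGraph {q : L2 × L2} (hq : q ∈ testGraph) :
    ∃ k : FormSpace, embed k = q.1 ∧ grad k = q.2 :=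
  ⟨⟨WithLp.toLp 2 q, subset_closure hq⟩, rfl, rfl⟩

/-- The weak derivative on `H¹` is minus the adjoint of the derivative on `H¹₀`: by continuity, test
functions may be replaced by all of `H¹₀`. -/
theorem isWeakDeriv_iff (w w' : L2) :
    IsWeakDeriv w w' ↔ ∀ k, ⟪embed k, w'⟫_ℂ = -⟪grad k, w⟫_ℂ := by
  rw [isWeakDeriv_iff_testGraph]
  refine ⟨fun h k => formSpace_induction (p := fun q => ⟪q.1, w'⟫_ℂ = -⟪q.2, w⟫_ℂ)
    (isClosed_eq (by fun_prop) (by fun_prop)) h k, fun h q hq => ?_⟩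
  obtain ⟨k, h1, h2⟩ := exists_formSpace_of_testGraph hq
  rw [← h1, ← h2, h]

theorem isWeakDeriv_grad (k : FormSpace) : IsWeakDeriv (embed k) (grad k) := by
  refine formSpace_induction (p := fun q => IsWeakDeriv q.1 q.2) ?_
    (fun q hq => testGraph_le_weakDerivGraph hq) k
  simp only [isWeakDeriv_iff_testGraph, ofPred_forall]
  exact isClosed_iInter fun q => isClosed_iInter fun _ =>
    isClosed_eq (by fun_prop) (by fun_prop)

theorem embed_injective : Function.Injective embed := by
  refine (injective_iff_map_eq_zero _).2 fun k hk => ?_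
  have h1 : grad k = 0 :=
    weakDerivGraph_snd_eq_zero (embed k, grad k) (isWeakDeriv_grad k) hk
  rw [← norm_eq_zero, ← sq_eq_zero_iff, formSpace_norm_sq, hk, h1]
  simp

/-- A vector orthogonal to the range would be a weak derivative of `0`, hence is `0`. -/
theorem embed_denseRange : DenseRange embed := by
  refine denseRange_of_adjoint_injective ((injective_iff_map_eq_zero _).2 fun w hw => ?_)
  refine weakDerivGraph_snd_eq_zero (0, w) ((isWeakDeriv_iff _ _).2 fun k => ?_) rfl
  rw [inner_zero_right, neg_zero, ← ContinuousLinearMap.adjoint_inner_right, hw, inner_zero_right]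

/-- The Hilbert sum and the product carry the same topology, and limits of test pairs are
automatically weak-derivative pairs. -/
theorem range_embed : range embed = (H10 : Set L2) := by
  have hcl : ∀ q : L2 × L2, q ∈ testGraph.topologicalClosure ↔ WithLp.toLp 2 q ∈ sobolevGraph := by
    intro q
    have := (WithLp.prodContinuousLinearEquiv 2 ℂ L2 L2).toHomeomorph.preimage_closure
      (testGraph : Set (L2 × L2))
    exact (Set.ext_iff.1 this (WithLp.toLp 2 q))
  ext u
  constructor
  · rintro ⟨k, rfl⟩
    exact ⟨(embed k, grad k), ⟨isWeakDeriv_grad k, (hcl _).2 k.2⟩, rfl⟩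
  · rintro ⟨q, ⟨-, hq⟩, rfl⟩
    exact ⟨⟨WithLp.toLp 2 q, (hcl q).1 hq⟩, rfl⟩

end FormSpace

/-! ### Multiplication by `x` on `L²` and on `H¹₀`. -/

section Position

/-- The position operator as a bounded operator. -/
def positionL : L2 →L[ℂ] L2 := position.mkContinuous 1 fun u => by
  rw [one_mul]
  refine Lp.norm_le_norm_of_ae_le ?_
  filter_upwards [coeFn_position u, ae_restrict_mem measurableSet_Ioo] with x hx hxΩ
  rw [hx, norm_mul]
  refine mul_le_of_le_one_left (norm_nonneg _) ?_
  rw [Complex.norm_real, Real.norm_eq_abs, abs_le]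
  constructor <;> linarith [hxΩ.1, hxΩ.2]

theorem positionL_apply (u : L2) : positionL u = position u := rfl

theorem positionL_isSelfAdjoint : IsSelfAdjoint positionL := by
  refine ContinuousLinearMap.ext fun u => ext_inner_right ℂ fun v => ?_
  rw [inner_star_left, L2.inner_def, L2.inner_def]
  refine integral_congr_ae ?_
  filter_upwards [coeFn_position u, coeFn_position v] with x hu hv
  simp only [positionL_apply, hu, hv, RCLike.inner_apply, map_mul, Complex.conj_ofReal]
  ring

theorem mul_mem_testGraph {q : L2 × L2} (hq : q ∈ testGraph) :
    (positionL q.1, positionL q.2 + q.1) ∈ testGraph := by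
  obtain ⟨φ, hφ, h1, h2⟩ := hq
  refine ⟨_, hφ.mul_id, ?_, ?_⟩
  · filter_upwards [coeFn_position q.1, h1] with x hx hx1
    rw [positionL_apply, hx, hx1]
  · filter_upwards [coeFn_position q.2, h1, h2, Lp.coeFn_add (positionL q.2) q.1] with x hx hx1 hx2 hx3
    have h3 : HasDerivAt (fun x : ℝ => (x : ℂ)) 1 x := Complex.ofRealCLM.hasDerivAt
    have h4 := (hφ.smooth.differentiable (by simp) x).hasDerivAt
    rw [(h3.fun_mul h4).deriv, hx3, Pi.add_apply, positionL_apply, hx, hx1, hx2]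
    ring

/-- Multiplication by `x` on `H¹₀(Ω)`. -/
def positionK : FormSpace →L[ℂ] FormSpace :=
  (((WithLp.prodContinuousLinearEquiv 2 ℂ L2 L2).symm : L2 × L2 →L[ℂ] WithLp 2 (L2 × L2)) ∘L
    ((positionL ∘L embed).prod (positionL ∘L grad + embed))).codRestrict sobolevGraph fun k => by
      have hc : Continuous fun y : WithLp 2 (L2 × L2) =>
          WithLp.toLp 2 (positionL y.fst, positionL y.snd + y.fst) := by fun_prop
      have : WithLp.toLp 2 (positionL (embed k), positionL (grad k) + embed k) ∈ sobolevGraph :=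
        map_mem_closure (f := fun y : WithLp 2 (L2 × L2) =>
          WithLp.toLp 2 (positionL y.fst, positionL y.snd + y.fst)) hc k.2
          fun x hx => mul_mem_testGraph (q := (x.fst, x.snd)) hx
      exact this

theorem embed_positionK (k : FormSpace) : embed (positionK k) = positionL (embed k) := rfl

theorem grad_positionK (k : FormSpace) :
    grad (positionK k) = positionL (grad k) + embed k := rfl

theorem isGauge_position : IsGauge embed grad positionL 1 positionK where
  isSelfAdjoint := positionL_isSelfAdjoint
  commute := Commute.one_left _
  map_J := embed_positionK
  map_D := grad_positionK

/-- Here `[∂, x²] = 2x`, written as a sum. -/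
theorem isGauge_position_sq :
    IsGauge embed grad (positionL * positionL) (positionL + positionL) (positionK * positionK) where
  isSelfAdjoint := by
    rw [IsSelfAdjoint, star_mul, positionL_isSelfAdjoint.star_eq]
  commute := ((Commute.refl _).mul_right (Commute.refl _)).add_left
    ((Commute.refl _).mul_right (Commute.refl _))
  map_J k := by simp only [mul_apply_eq_comp, embed_positionK]
  map_D k := by
    simp only [mul_apply_eq_comp, embed_positionK, grad_positionK, map_add, add_apply]
    abel

theorem IsWeakDeriv.positionL {u v : L2} (h : IsWeakDeriv u v) :
    IsWeakDeriv (positionL u) (positionL v + u) := by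
  rw [isWeakDeriv_iff] at *
  intro k
  have h1 := h (positionK k)
  have h2 : ∀ x y, ⟪MovingBox.positionL x, y⟫_ℂ = ⟪x, MovingBox.positionL y⟫_ℂ := fun x y => by
    rw [← inner_star_left, positionL_isSelfAdjoint.star_eq]
  rw [embed_positionK, grad_positionK, h2, inner_add_left, h2] at h1
  rw [inner_add_right, h1]
  ring

theorem IsWeakDeriv.add {u v u' v' : L2} (h : IsWeakDeriv u v) (h' : IsWeakDeriv u' v') :
    IsWeakDeriv (u + u') (v + v') := weakDerivGraph.add_mem (x := (u, v)) (y := (u', v')) h h'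

theorem IsWeakDeriv.sub {u v u' v' : L2} (h : IsWeakDeriv u v) (h' : IsWeakDeriv u' v') :
    IsWeakDeriv (u - u') (v - v') := weakDerivGraph.sub_mem (x := (u, v)) (y := (u', v')) h h'

theorem IsWeakDeriv.smul {u v : L2} (c : ℂ) (h : IsWeakDeriv u v) :
    IsWeakDeriv (c • u) (c • v) := weakDerivGraph.smul_mem (x := (u, v)) c h

end Position

/-! ### The transformed Hamiltonian as a magnetic form operator. -/

section Operator

/-- The vector potential of the transformed Hamiltonian. -/
def vectorPotential (l l' d' : ℝ) : L2 →L[ℂ] L2 :=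
  ((l * l' / 2 : ℝ) : ℂ) • positionL + ((l * d' / 2 : ℝ) : ℂ) • 1

/-- The scalar potential of the transformed Hamiltonian. -/
def scalarPotential (l l' d' : ℝ) : L2 →L[ℂ] L2 :=
  -((1 / l ^ 2 : ℝ) : ℂ) • (vectorPotential l l' d' * vectorPotential l l' d')

theorem vectorPotential_isSelfAdjoint (l l' d' : ℝ) : IsSelfAdjoint (vectorPotential l l' d') := by
  rw [IsSelfAdjoint, vectorPotential, star_add, star_smul, star_smul, star_one,
    positionL_isSelfAdjoint.star_eq, Complex.star_def, Complex.conj_ofReal, Complex.conj_ofReal]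

theorem scalarPotential_isSelfAdjoint (l l' d' : ℝ) : IsSelfAdjoint (scalarPotential l l' d') := by
  rw [IsSelfAdjoint, scalarPotential, star_smul, star_mul,
    (vectorPotential_isSelfAdjoint l l' d').star_eq, star_neg, Complex.star_def,
    Complex.conj_ofReal]

theorem IsWeakDeriv.vectorPotential {u v : L2} (h : IsWeakDeriv u v) (l l' d' : ℝ) :
    IsWeakDeriv (vectorPotential l l' d' u)
      (vectorPotential l l' d' v + ((l * l' / 2 : ℝ) : ℂ) • u) := by
  have h1 := (h.positionL.smul ((l * l' / 2 : ℝ) : ℂ)).add (h.smul ((l * d' / 2 : ℝ) : ℂ))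
  rw [smul_add, add_right_comm] at h1
  exact h1

/-- One integration by parts: the form at `k` is represented by `-κ (∂ - iA)² k + W k`. -/
theorem magneticForm_eq_adjoint {κ : ℝ} {A W : L2 →L[ℂ] L2} (hA : IsSelfAdjoint A) {k : FormSpace}
    {y : L2} (hy : IsWeakDeriv (covDeriv embed grad A k) y) :
    magneticForm embed grad κ A W k = adjoint embed
      ((κ : ℂ) • (-y + Complex.I • A (covDeriv embed grad A k)) + W (embed k)) := by
  refine ext_inner_left ℂ fun Φ => ?_
  have h1 := (isWeakDeriv_iff _ _).1 hy Φ
  rw [inner_magneticForm, ContinuousLinearMap.adjoint_inner_right, covDeriv_apply _ _ _ Φ,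
    inner_sub_left, inner_smul_left, ← hA.star_eq, inner_star_left, hA.star_eq, inner_add_right,
    inner_smul_right, inner_add_right, inner_neg_right, h1, inner_smul_right, Complex.conj_I]
  ring

/-- Regularity: if the form at `k` is represented by an `L²` function `f`, the equation can be
solved for the weak derivative of `(∂ - iA) k`. -/
theorem isWeakDeriv_of_magneticForm_eq {κ : ℝ} (hκ : κ ≠ 0) {A W : L2 →L[ℂ] L2}
    (hA : IsSelfAdjoint A) {k : FormSpace} {f : L2}
    (hf : magneticForm embed grad κ A W k = adjoint embed f) :
    ∃ y, IsWeakDeriv (covDeriv embed grad A k) y := by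
  refine ⟨Complex.I • A (covDeriv embed grad A k) - (κ : ℂ)⁻¹ • (f - W (embed k)),
    (isWeakDeriv_iff _ _).2 fun Φ => ?_⟩
  have h1 : ⟪Φ, magneticForm embed grad κ A W k⟫_ℂ = ⟪embed Φ, f⟫_ℂ := by
    rw [hf, ContinuousLinearMap.adjoint_inner_right]
  rw [inner_magneticForm, covDeriv_apply _ _ _ Φ, inner_sub_left, inner_smul_left, ← hA.star_eq,
    inner_star_left, hA.star_eq, Complex.conj_I] at h1
  rw [inner_sub_right, inner_smul_right, inner_smul_right, inner_sub_right, ← h1]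
  have : (κ : ℂ) ≠ 0 := Complex.ofReal_ne_zero.2 hκ
  field_simp
  ring

/-- Completing the square: `Ap + pA = l l' x ∘ p + l d' p`, and the superfluous `A² / l²` is removed
by the scalar potential. -/
theorem transformedOp_apply {l l' d' : ℝ} (hl : 0 < l) (u : DDir) {v w : L2}
    (hv : IsWeakDeriv (u : L2) v) (hw : IsWeakDeriv v w) :
    (transformedOp l l' d' u : L2) = ((1 / l ^ 2 : ℝ) : ℂ) • (-(w -
        Complex.I • (vectorPotential l l' d' v + ((l * l' / 2 : ℝ) : ℂ) • (u : L2))) +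
      Complex.I • vectorPotential l l' d' (v - Complex.I • vectorPotential l l' d' u)) +
      scalarPotential l l' d' u := by
  have h1 : dx (Submodule.inclusion DDir_le_H1 u) = v := dx_eq hv
  have h2 : laplacianDir u = -w := congrArg Neg.neg (dx_eq (by rwa [← h1] at hw))
  have h3 : momentum (Submodule.inclusion DDir_le_H1 u) = -Complex.I • v :=
    congrArg (-Complex.I • ·) h1
  have h4 : symmXP (Submodule.inclusion DDir_le_H1 u) =
      (1 / 2 : ℂ) • (positionL (-Complex.I • v) + -Complex.I • (positionL v + (u : L2))) := by
    have h5 : momentum (position.restrict (fun _ => position_mem_H1)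
        (Submodule.inclusion DDir_le_H1 u)) = -Complex.I • (positionL v + (u : L2)) :=
      congrArg (-Complex.I • ·) (dx_eq hv.positionL)
    have h6 : position (momentum (Submodule.inclusion DDir_le_H1 u)) =
        positionL (-Complex.I • v) := congrArg position h3
    rw [← h5, ← h6]
    rfl
  have h7 : (transformedOp l l' d' u : L2) = ((1 / l ^ 2 : ℝ) : ℂ) • laplacianDir u
    - ((l' / l : ℝ) : ℂ) • symmXP (Submodule.inclusion DDir_le_H1 u)
    - ((d' / l : ℝ) : ℂ) • momentum (Submodule.inclusion DDir_le_H1 u) := rfl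
  have hlc : (l : ℂ) ≠ 0 := Complex.ofReal_ne_zero.2 hl.ne'
  rw [h7, h2, h3, h4]
  simp only [scalarPotential, vectorPotential, add_apply, smul_apply, mul_apply_eq_comp, map_add,
    map_sub, map_smul, one_apply_eq_self]
  push_cast
  match_scalars <;> field_simp <;> ring_nf <;> simp only [Complex.I_sq] <;> ring

theorem mem_DDir_of {u v w : L2} (hu : u ∈ H10) (hv : IsWeakDeriv u v) (hw : IsWeakDeriv v w) :
    u ∈ DDir := by
  have h1 : u ∈ H1 := mem_H1_iff.2 ⟨v, hv⟩
  refine ⟨hu, mem_H2_iff.2 ⟨h1, ?_⟩⟩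
  rw [dx_eq hv]
  exact mem_H1_iff.2 ⟨w, hw⟩

/-- The transformed Hamiltonian is the operator of its magnetic form. -/
theorem isFormOperator_transformedOp {l : ℝ} (hl : 0 < l) (l' d' : ℝ) :
    IsFormOperator embed (magneticForm embed grad (1 / l ^ 2) (vectorPotential l l' d')
      (scalarPotential l l' d')) (transformedOp l l' d') where
  injective := embed_injective
  denseRange := embed_denseRange
  isSelfAdjoint_form := magneticForm_isSelfAdjoint _ _ (scalarPotential_isSelfAdjoint l l' d')
  coercive := magneticForm_coercive formSpace_norm_sq (by positivity) _ _
  mem_graph_iff u f := by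
    have hA := vectorPotential_isSelfAdjoint l l' d'
    have key : ∀ (u : DDir) (k : FormSpace) (w : L2), embed k = u → IsWeakDeriv (grad k) w →
        magneticForm embed grad (1 / l ^ 2) (vectorPotential l l' d') (scalarPotential l l' d') k =
          adjoint embed (transformedOp l l' d' u) := by
      intro u k w hk hw
      have hv := isWeakDeriv_grad k
      rw [hk] at hv
      have hc : IsWeakDeriv (covDeriv embed grad (vectorPotential l l' d') k) (w -
          Complex.I • (vectorPotential l l' d' (grad k) + ((l * l' / 2 : ℝ) : ℂ) • (u : L2))) := by
        rw [covDeriv_apply, hk]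
        exact hw.sub ((hv.vectorPotential l l' d').smul _)
      rw [magneticForm_eq_adjoint hA hc, transformedOp_apply hl u hv hw, covDeriv_apply, hk]
    rw [LinearPMap.mem_graph_iff]
    constructor
    · rintro ⟨y, rfl, rfl⟩
      obtain ⟨k, hk⟩ : (y : L2) ∈ range embed := range_embed ▸ y.2.1
      refine ⟨k, hk, ?_⟩
      have h1 : dx (Submodule.inclusion DDir_le_H1 y) = grad k :=
        dx_eq (by
          have := isWeakDeriv_grad k
          rwa [hk] at this)
      obtain ⟨w, hw⟩ := mem_H1_iff.1 (dx_mem_H1 y)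
      rw [h1] at hw
      exact key y k w hk hw
    · rintro ⟨k, rfl, hk⟩
      obtain ⟨y, hy⟩ := isWeakDeriv_of_magneticForm_eq (by positivity) hA hk
      -- Adding back `iA k`, which is in `H¹`, shows that `∂k` itself is in `H¹`.
      have h1 := hy.add (((isWeakDeriv_grad k).vectorPotential l l' d').smul Complex.I)
      rw [covDeriv_apply, sub_add_cancel] at h1
      have hmem : embed k ∈ DDir :=
        mem_DDir_of (range_embed.le (mem_range_self k)) (isWeakDeriv_grad k) h1
      refine ⟨⟨embed k, hmem⟩, rfl, adjoint_injective_of_denseRange embed_denseRange ?_⟩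
      rw [← hk]
      exact (key ⟨embed k, hmem⟩ k _ rfl h1).symm

end Operator

end

/-! ### The weak equation and the evolution of the transformed Hamiltonian. -/

noncomputable section

section WeakEquation

/-- On `H¹₀(Ω)` the form `κ ⟪∂ ·, ∂ ·⟫ + ⟪·, (W + κ) ·⟫` is `κ ⟪·, ·⟫ + ⟪·, W ·⟫`, with the inner
product of `H¹₀(Ω)` in the first term. -/
theorem isTripleSolution_iff {κ : ℝ → ℝ} {W : ℝ → L2 →L[ℂ] L2} {I : Set ℝ} {ψ : ℝ → L2} {t : ℝ} :
    IsTripleSolution embed κ W I ψ t ↔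
      IsMagneticSolution embed grad (κ t) 0 (W t + (κ t : ℂ) • 1) I ψ t := by
  refine exists_congr fun k => and_congr_right fun hk => forall_congr' fun Φ => ?_
  have : (κ t : ℂ) * ⟪Φ, k⟫_ℂ + ⟪embed Φ, W t (ψ t)⟫_ℂ =
      κ t * ⟪covDeriv embed grad 0 Φ, covDeriv embed grad 0 k⟫_ℂ +
        ⟪embed Φ, (W t + (κ t : ℂ) • 1) (ψ t)⟫_ℂ := by
    rw [formSpace_inner, covDeriv_apply, covDeriv_apply, add_apply, smul_apply, one_apply_eq_self,
      inner_add_right, inner_smul_right, hk]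
    simp only [zero_apply, smul_zero, sub_zero]
    ring
  rw [this]

theorem isMagneticSolution_iff {l : ℝ} (hl : 0 < l) (l' d' : ℝ) {I : Set ℝ} {ψ : ℝ → L2} {t : ℝ} :
    IsMagneticSolution embed grad (1 / l ^ 2) (vectorPotential l l' d') (scalarPotential l l' d')
        I ψ t ↔
      ∀ Φ ∈ (H10 : Set L2), ∃ z : ℂ, HasDerivWithinAt (fun r => ⟪Φ, ψ r⟫_ℂ) z I t ∧
        HasFormValue (transformedOp l l' d') Φ (ψ t) (Complex.I * z) := by
  have hA := isFormOperator_transformedOp hl l' d'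
  have hI : ∀ z : ℂ, Complex.I * (-Complex.I * z) = z := fun z => by
    rw [← mul_assoc, mul_neg, Complex.I_mul_I, neg_neg, one_mul]
  simp only [← range_embed, forall_mem_range]
  constructor
  · rintro ⟨k, hk, h⟩ Φ
    refine ⟨_, h Φ, ?_⟩
    rw [hI, ← hk, ← inner_magneticForm]
    exact hA.hasFormValue Φ k
  · intro h
    -- Any test vector would do: only membership of `ψ t` in the form domain is extracted.
    obtain ⟨z, -, hz⟩ := h 0
    obtain ⟨k, hk⟩ := hA.formDomain_eq.le hz.2.1
    refine ⟨k, hk, fun Φ => ?_⟩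
    obtain ⟨w, hw, hv⟩ := h Φ
    rw [← hk] at hv
    have h1 := (hA.hasFormValue Φ k).unique hv
    refine hw.congr_deriv ?_
    rw [← hk, ← inner_magneticForm, h1, ← mul_assoc, neg_mul, Complex.I_mul_I, neg_neg, one_mul]

end WeakEquation

section Propagator

variable {E : Type*} [NormedAddCommGroup E] [InnerProductSpace ℂ E] [CompleteSpace E]

theorem isUnitaryPropagator_of_unitary {I : Set ℝ} {Q : ℝ → E →L[ℂ] E}
    (hQ : ∀ t, Q t ∈ unitary (E →L[ℂ] E)) (hc : ∀ x, ContinuousOn (fun t => Q t x) I) :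
    IsUnitaryPropagator I fun t s => Q t * star (Q s) where
  unitary_mem t _ s _ := mul_mem (hQ t) (Unitary.star_mem (hQ s))
  comp_eq t _ s _ r _ := by
    rw [mul_assoc, ← mul_assoc (star (Q s)), (Unitary.mem_iff.1 (hQ s)).1, one_mul]
  strongly_continuous Ψ := by
    have hn : ∀ t, ‖Q t‖ ≤ 1 := fun t => norm_le_one_of_isometry (unitary_norm_apply (hQ t))
    -- Adjoints need not inherit strong continuity; here unitarity gives `‖Q_r* Ψ - Q_s* Ψ‖ = ‖Q_s
    -- Q_s* Ψ - Q_r Q_s* Ψ‖`.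
    have hstar : ContinuousOn (fun s => star (Q s) Ψ) I := by
      intro s hs
      rw [ContinuousWithinAt, tendsto_iff_norm_sub_tendsto_zero]
      have h1 : Tendsto (fun r => ‖Q s (star (Q s) Ψ) - Q r (star (Q s) Ψ)‖) (𝓝[I] s) (𝓝 0) := by
        simpa using ((hc (star (Q s) Ψ) s hs).tendsto.const_sub (Q s (star (Q s) Ψ))).norm
      refine h1.congr fun r => ?_
      rw [← unitary_norm_apply (hQ r) (star (Q r) Ψ - star (Q s) Ψ), map_sub,
        unitary_apply_star (hQ r), unitary_apply_star (hQ s)]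
    intro q hq
    refine tendsto_strong_apply (T := fun q : ℝ × ℝ => Q q.1) (T₀ := Q q.1) (fun q => hn q.1) ?_ ?_
    · exact (hc _ q.1 hq.1).tendsto.comp
        (continuousWithinAt_fst.tendsto_nhdsWithin fun _ h => h.1)
    · exact (hstar q.2 hq.2).tendsto.comp
        (continuousWithinAt_snd.tendsto_nhdsWithin fun _ h => h.2)

end Propagator

section Evolution

/-- The quadratic polynomial `p₂ T² + p₁ T + p₀` of a bounded operator `T`. -/
def quadPoly {F : Type*} [NormedAddCommGroup F] [NormedSpace ℂ F] (T : F →L[ℂ] F) (p₀ p₁ p₂ : ℝ) :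
    F →L[ℂ] F :=
  (p₂ : ℂ) • (T * T) + (p₁ : ℂ) • T + (p₀ : ℂ) • 1

theorem ContinuousOn.quadPoly {F : Type*} [NormedAddCommGroup F] [NormedSpace ℂ F]
    (T : F →L[ℂ] F) {p₀ p₁ p₂ : ℝ → ℝ} {I : Set ℝ} (h₀ : ContinuousOn p₀ I)
    (h₁ : ContinuousOn p₁ I) (h₂ : ContinuousOn p₂ I) :
    ContinuousOn (fun t => quadPoly T (p₀ t) (p₁ t) (p₂ t)) I := by
  have hof : ∀ {p : ℝ → ℝ}, ContinuousOn p I → ContinuousOn (fun t => (p t : ℂ)) I :=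
    fun hp => Complex.continuous_ofReal.comp_continuousOn hp
  exact (((hof h₂).smul continuousOn_const).add ((hof h₁).smul continuousOn_const)).add
    ((hof h₀).smul continuousOn_const)

theorem exists_bound_quadPoly {F : Type*} [NormedAddCommGroup F] [NormedSpace ℂ F]
    (T : F →L[ℂ] F) {p₀ p₁ p₂ : ℝ → ℝ} {a b : ℝ} (h₀ : ContinuousOn p₀ (Icc a b))
    (h₁ : ContinuousOn p₁ (Icc a b)) (h₂ : ContinuousOn p₂ (Icc a b)) :
    ∃ C, ∀ t ∈ Icc a b, ‖quadPoly T (p₀ t) (p₁ t) (p₂ t)‖ ≤ C :=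
  isCompact_Icc.exists_bound_of_continuousOn (ContinuousOn.quadPoly T h₀ h₁ h₂)

theorem quadPoly_isSelfAdjoint {p₀ p₁ p₂ : ℝ} : IsSelfAdjoint (quadPoly positionL p₀ p₁ p₂) := by
  simp only [IsSelfAdjoint, quadPoly, star_add, star_smul, star_mul, star_one,
    positionL_isSelfAdjoint.star_eq, Complex.star_def, Complex.conj_ofReal]

theorem quadPoly_commute {p₀ p₁ p₂ : ℝ} : Commute (quadPoly positionL p₀ p₁ p₂) positionL :=
  (((((Commute.refl _).mul_left (Commute.refl _)).smul_left _)).add_left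
    ((Commute.refl _).smul_left _)).add_left ((Commute.one_left _).smul_left _)

theorem embed_quadPoly {p₀ p₁ p₂ : ℝ} (k : FormSpace) :
    embed (quadPoly positionK p₀ p₁ p₂ k) = quadPoly positionL p₀ p₁ p₂ (embed k) := by
  simp only [quadPoly, add_apply, smul_apply, mul_apply_eq_comp, one_apply_eq_self, map_add,
    map_smul, embed_positionK]

theorem scalarPotential_eq {l : ℝ} (hl : 0 < l) (l' d' : ℝ) : scalarPotential l l' d' =
    quadPoly positionL (-(d' ^ 2 / 4)) (-(l' * d' / 2)) (-(l' ^ 2 / 4)) := by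
  have hlc : (l : ℂ) ≠ 0 := Complex.ofReal_ne_zero.2 hl.ne'
  rw [scalarPotential, vectorPotential, quadPoly]
  simp only [add_mul, mul_add, smul_mul_assoc, mul_smul_comm, mul_one, one_mul]
  push_cast
  match_scalars <;> field_simp <;> ring

/-- Existence of the evolution of the transformed Hamiltonian, and uniqueness of weak solutions of
the Schrödinger equation. -/
theorem exists_transformed_evolution {a b : ℝ} (hab : a ≤ b) {l l₁ l₂ d₁ d₂ : ℝ → ℝ}
    (hl : ∀ t ∈ Icc a b, HasDerivWithinAt l (l₁ t) (Icc a b) t)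
    (hl₁ : ∀ t ∈ Icc a b, HasDerivWithinAt l₁ (l₂ t) (Icc a b) t)
    (hd₁ : ∀ t ∈ Icc a b, HasDerivWithinAt d₁ (d₂ t) (Icc a b) t)
    (hl₂ : ContinuousOn l₂ (Icc a b)) (hd₂ : ContinuousOn d₂ (Icc a b))
    (hpos : ∀ t ∈ Icc a b, 0 < l t) :
    ∃ Q : ℝ → L2 →L[ℂ] L2, (∀ t, Q t ∈ unitary (L2 →L[ℂ] L2)) ∧
      (∀ x, ContinuousOn (fun t => Q t x) (Icc a b)) ∧
      (∀ s k, ∀ t ∈ Icc a b, IsMagneticSolution embed grad (1 / l t ^ 2)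
        (vectorPotential (l t) (l₁ t) (d₁ t)) (scalarPotential (l t) (l₁ t) (d₁ t)) (Icc a b)
        (fun r => Q r (star (Q s) (embed k))) t) ∧
      ∀ ψ : ℝ → L2, ContinuousOn ψ (Icc a b) →
        (∀ t ∈ Icc a b, IsMagneticSolution embed grad (1 / l t ^ 2)
          (vectorPotential (l t) (l₁ t) (d₁ t)) (scalarPotential (l t) (l₁ t) (d₁ t)) (Icc a b)
          ψ t) →
        ∀ t ∈ Icc a b, ∀ s ∈ Icc a b, ψ t = Q t (star (Q s) (ψ s)) := by
  have hlc : ContinuousOn l (Icc a b) := fun t ht => (hl t ht).continuousWithinAt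
  have hl₁c : ContinuousOn l₁ (Icc a b) := fun t ht => (hl₁ t ht).continuousWithinAt
  have hd₁c : ContinuousOn d₁ (Icc a b) := fun t ht => (hd₁ t ht).continuousWithinAt
  -- Chosen so that `2 c₁ x + c₂`, the derivative of the phase `c₁ x² + c₂ x`, is the vector
  -- potential.
  set c₁ : ℝ → ℝ := fun t => l t * l₁ t / 4 with hc₁
  set c₂ : ℝ → ℝ := fun t => l t * d₁ t / 2 with hc₂
  set c₁' : ℝ → ℝ := fun t => (l₁ t * l₁ t + l t * l₂ t) / 4 with hc₁'
  set c₂' : ℝ → ℝ := fun t => (l₁ t * d₁ t + l t * d₂ t) / 2 with hc₂'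
  have hc₁d : ∀ t ∈ Icc a b, HasDerivWithinAt c₁ (c₁' t) (Icc a b) t := fun t ht =>
    ((hl t ht).mul (hl₁ t ht)).div_const 4
  have hc₂d : ∀ t ∈ Icc a b, HasDerivWithinAt c₂ (c₂' t) (Icc a b) t := fun t ht =>
    ((hl t ht).mul (hd₁ t ht)).div_const 2
  have hc₁c : ContinuousOn c₁ (Icc a b) := fun t ht => (hc₁d t ht).continuousWithinAt
  have hc₂c : ContinuousOn c₂ (Icc a b) := fun t ht => (hc₂d t ht).continuousWithinAt
  set κ : ℝ → ℝ := fun t => 1 / l t ^ 2 with hκ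
  have hκc : ContinuousOn κ (Icc a b) :=
    continuousOn_const.div (hlc.pow 2) fun t ht => (pow_pos (hpos t ht) 2).ne'
  -- Coefficients of the potential left after removing the gauge: the scalar potential plus `c₁' x²
  -- + c₂' x`, minus the `κ` that completes the gradient term to the `H¹₀` inner product.
  set p₀ : ℝ → ℝ := fun t => -(d₁ t ^ 2 / 4) - κ t with hp₀
  set p₁ : ℝ → ℝ := fun t => c₂' t - l₁ t * d₁ t / 2 with hp₁
  set p₂ : ℝ → ℝ := fun t => c₁' t - l₁ t ^ 2 / 4 with hp₂
  have hp₀c : ContinuousOn p₀ (Icc a b) := by fun_prop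
  have hp₁c : ContinuousOn p₁ (Icc a b) := by fun_prop
  have hp₂c : ContinuousOn p₂ (Icc a b) := by fun_prop
  -- Clamping time to the interval extends the coefficients to bounded continuous functions on `ℝ`.
  let e : ℝ → ℝ := fun t => projIcc a b hab t
  have hec : Continuous e := continuous_subtype_val.comp continuous_projIcc
  have hemem : ∀ t, e t ∈ Icc a b := fun t => (projIcc a b hab t).2
  have he : ∀ t ∈ Icc a b, e t = t := fun t ht => by simp only [e, projIcc_of_mem hab ht]
  have hWc := ContinuousOn.quadPoly positionL hp₀c hp₁c hp₂c
  have hWKc := ContinuousOn.quadPoly positionK hp₀c hp₁c hp₂c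
  obtain ⟨C, hC⟩ := exists_bound_quadPoly positionL hp₀c hp₁c hp₂c
  obtain ⟨CK, hCK⟩ := exists_bound_quadPoly positionK hp₀c hp₁c hp₂c
  set W : ℝ → L2 →L[ℂ] L2 := fun t => quadPoly positionL (p₀ (e t)) (p₁ (e t)) (p₂ (e t)) with hW
  obtain ⟨Q, hQ, hQc, hQsol, hQuniq⟩ := exists_triple_evolution (κ := fun t => κ (e t)) (W := W)
    embed_injective embed_denseRange (hκc.comp_continuous hec hemem)
    (hWc.comp_continuous hec hemem) (fun t => hC _ (hemem t)) (fun t => quadPoly_isSelfAdjoint)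
    (hWKc.comp_continuous hec hemem) (fun t => hCK _ (hemem t)) (fun t k => embed_quadPoly k) hab
  set Y : L2 →L[ℂ] L2 := positionL * positionL with hY
  have hWX : ∀ t, Commute (W t + ((κ (e t) : ℝ) : ℂ) • 1) positionL := fun t =>
    quadPoly_commute.add_left ((Commute.one_left _).smul_left _)
  have hXX : Commute positionL positionL := Commute.refl _
  have hXY : Commute positionL Y := hXX.mul_right hXX
  have hYX : Commute Y positionL := hXY.symm
  have hA : ∀ t, (0 : L2 →L[ℂ] L2) + (c₁ t : ℂ) • (positionL + positionL) + (c₂ t : ℂ) • 1 =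
      vectorPotential (l t) (l₁ t) (d₁ t) := by
    intro t
    rw [vectorPotential, zero_add, hc₁, hc₂]
    push_cast
    module
  have hpot : ∀ t ∈ Icc a b, W t + ((κ (e t) : ℝ) : ℂ) • 1 - (c₁' t : ℂ) • Y - (c₂' t : ℂ) • positionL =
      scalarPotential (l t) (l₁ t) (d₁ t) := by
    intro t ht
    rw [scalarPotential_eq (hpos t ht), hW, hY]
    simp only [he t ht, quadPoly, hp₀, hp₁, hp₂]
    push_cast
    module
  let M : ℝ → L2 →L[ℂ] L2 := fun t => expI positionL (c₂ t) * expI Y (c₁ t)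
  have hYsa : IsSelfAdjoint Y := isGauge_position_sq.isSelfAdjoint
  have hM : ∀ t, M t ∈ unitary (L2 →L[ℂ] L2) := fun t =>
    mul_mem (expI_mem_unitary positionL_isSelfAdjoint _) (expI_mem_unitary hYsa _)
  have hMstar : ∀ t x, star (M t) x = expI Y (-c₁ t) (expI positionL (-c₂ t) x) := by
    intro t x
    conv_lhs => rw [← expI_apply_neg positionL (c₂ t) x,
      ← expI_apply_neg Y (c₁ t) (expI positionL (-c₂ t) x)]
    exact unitary_star_apply (hM t) _
  have hMc : ContinuousOn M (Icc a b) :=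
    ((continuous_expI _).comp_continuousOn hc₂c).mul ((continuous_expI _).comp_continuousOn hc₁c)
  have hQMstar : ∀ t x, star (M t * Q t) x = star (Q t) (star (M t) x) := fun t x => by
    rw [star_mul, mul_apply_eq_comp]
  refine ⟨fun t => M t * Q t, fun t => mul_mem (hM t) (hQ t),
    fun x => hMc.clm_apply (hQc x).continuousOn, ?_, ?_⟩
  · intro s k t ht
    set k' : FormSpace := expI (positionK * positionK) (-c₁ s) (expI positionK (-c₂ s) k) with hk'
    have hk : star (M s) (embed k) = embed k' := by
      rw [hMstar, hk', isGauge_position_sq.map_expI, isGauge_position.map_expI]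
    have h1 := isTripleSolution_iff.1 (hQsol s k' t)
    have h2 : IsMagneticSolution embed grad (κ (e t)) 0 (W t + ((κ (e t) : ℝ) : ℂ) • 1) (Icc a b)
        (fun r => Q r (star (Q s) (embed k'))) t :=
      ⟨h1.choose, h1.choose_spec.1, fun Φ => (h1.choose_spec.2 Φ).mono (subset_univ _)⟩
    have hcont : Continuous fun r => Q r (star (Q s) (embed k')) := hQc _
    -- The quadratic and the linear part of the phase are applied one after the other.
    have h3 := h2.gauge hcont.continuousWithinAt isGauge_position_sq (Commute.zero_left _)
      ((hWX t).mul_right (hWX t)) (hc₁d t ht)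
    have h4 := h3.gauge
      (((continuous_expI Y).comp_continuousOn hc₁c).clm_apply hcont.continuousOn t ht)
      isGauge_position
      ((Commute.zero_left _).add_left ((hXX.add_left hXX).smul_left _))
      ((hWX t).sub_left (hYX.smul_left _)) (hc₂d t ht)
    rw [hA, hpot t ht, he t ht] at h4
    simp only [hQMstar, hk]
    exact h4
  · intro ψ hψc hψ
    -- The inverse gauge takes an arbitrary weak solution to the form for which uniqueness is known.
    set φ : ℝ → L2 := fun r => expI Y (-c₁ r) (expI positionL (-c₂ r) (ψ r)) with hφ
    have hψ₁c : ContinuousOn (fun r => expI positionL (-c₂ r) (ψ r)) (Icc a b) :=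
      ((continuous_expI positionL).comp_continuousOn hc₂c.neg).clm_apply hψc
    have hφc : ContinuousOn φ (Icc a b) :=
      ((continuous_expI Y).comp_continuousOn hc₁c.neg).clm_apply hψ₁c
    have hφsol : ∀ t ∈ Icc a b, IsTripleSolution embed (fun t => κ (e t)) W (Icc a b) φ t := by
      intro t ht
      have h1 := hψ t ht
      rw [← hA, ← hpot t ht] at h1
      have hWX' := (hWX t).sub_left (hYX.smul_left (c₁' t : ℂ))
      have hWX'' := hWX'.sub_left (hXX.smul_left (c₂' t : ℂ))
      have hAX : Commute ((0 : L2 →L[ℂ] L2) + (c₁ t : ℂ) • (positionL + positionL) + (c₂ t : ℂ) • 1)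
          positionL := ((Commute.zero_left _).add_left ((hXX.add_left hXX).smul_left _)).add_left
            ((Commute.one_left _).smul_left _)
      have h2 := h1.gauge (hψc t ht) isGauge_position hAX hWX'' (hc₂d t ht).neg
      have hAX' : Commute ((0 : L2 →L[ℂ] L2) + (c₁ t : ℂ) • (positionL + positionL) + (c₂ t : ℂ) • 1 +
          (((-c₂) t : ℝ) : ℂ) • 1) positionL := hAX.add_left ((Commute.one_left _).smul_left _)
      have hW3 := hWX''.sub_left (hXX.smul_left ((-c₂' t : ℝ) : ℂ))
      have h3 := h2.gauge (hψ₁c t ht) isGauge_position_sq (hAX'.mul_right hAX')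
        (hW3.mul_right hW3) (hc₁d t ht).neg
      refine isTripleSolution_iff.2 ?_
      have e1 : (0 : L2 →L[ℂ] L2) + (c₁ t : ℂ) • (positionL + positionL) + (c₂ t : ℂ) • 1 + (((-c₂) t : ℝ) : ℂ) • 1 +
          (((-c₁) t : ℝ) : ℂ) • (positionL + positionL) = 0 := by
        simp only [Pi.neg_apply]
        push_cast
        module
      have e2 : W t + ((κ (e t) : ℝ) : ℂ) • 1 - (c₁' t : ℂ) • Y - (c₂' t : ℂ) • positionL -
          ((-c₂' t : ℝ) : ℂ) • positionL - ((-c₁' t : ℝ) : ℂ) • (positionL * positionL) =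
          W t + ((κ (e t) : ℝ) : ℂ) • 1 := by
        rw [← hY]
        push_cast
        module
      rw [e1, e2] at h3
      simp only [he t ht] at h3 ⊢
      exact h3
    have hφM : ∀ t, φ t = star (M t) (ψ t) := fun t => (hMstar t _).symm
    have hφt := hQuniq φ hφc hφsol
    intro t ht s hs
    have h5 : star (Q s) (φ s) = star (Q a) (φ a) := by
      conv_lhs => rw [hφt s hs]
      exact unitary_star_apply (hQ s) _
    rw [hQMstar, ← hφM, h5, mul_apply_eq_comp, ← hφt t ht, hφM]
    exact (unitary_apply_star (hM t) _).symm

end Evolution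

end

end MovingBox

/-! ### Assembly of the main theorem. -/

open MovingBox in
theorem proposition1 (a b : ℝ) (hab : a < b) (ℓ d : ℝ → ℝ)
    (hℓ : ContDiffOn ℝ 2 ℓ (Set.Icc a b)) (hd : ContDiffOn ℝ 2 d (Set.Icc a b))
    (hpos : ∀ t ∈ Set.Icc a b, 0 < ℓ t) :
    (∀ t ∈ Set.Icc a b,
      IsSelfAdjoint (MovingBox.transformedHamiltonian (Set.Icc a b) ℓ d t)) ∧
    MovingBox.IsUniformlySemibounded (Set.Icc a b)
      (MovingBox.transformedHamiltonian (Set.Icc a b) ℓ d) ∧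
    (∀ t ∈ Set.Icc a b,
      MovingBox.formDomain (MovingBox.transformedHamiltonian (Set.Icc a b) ℓ d t) =
        (MovingBox.H10 : Set MovingBox.L2)) ∧
    (∃ U : ℝ → ℝ → MovingBox.L2 →L[ℂ] MovingBox.L2,
      MovingBox.IsWeakSolution (Set.Icc a b)
        (MovingBox.transformedHamiltonian (Set.Icc a b) ℓ d) (MovingBox.H10 : Set MovingBox.L2) U ∧
      ∀ V : ℝ → ℝ → MovingBox.L2 →L[ℂ] MovingBox.L2,
        MovingBox.IsWeakSolution (Set.Icc a b)
          (MovingBox.transformedHamiltonian (Set.Icc a b) ℓ d)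
          (MovingBox.H10 : Set MovingBox.L2) V →
        ∀ t ∈ Set.Icc a b, ∀ s ∈ Set.Icc a b, V t s = U t s) := by
  have hU : UniqueDiffOn ℝ (Set.Icc a b) := uniqueDiffOn_Icc hab
  have hℓ' : ContDiffOn ℝ 1 (derivWithin ℓ (Set.Icc a b)) (Set.Icc a b) :=
    hℓ.derivWithin hU (by norm_num)
  have hd' : ContDiffOn ℝ 1 (derivWithin d (Set.Icc a b)) (Set.Icc a b) :=
    hd.derivWithin hU (by norm_num)
  have hform : ∀ t ∈ Set.Icc a b, IsFormOperator embed _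
      (transformedHamiltonian (Set.Icc a b) ℓ d t) := fun t ht =>
    isFormOperator_transformedOp (hpos t ht) _ _
  obtain ⟨Q, hQ, hQc, hQsol, hQuniq⟩ := exists_transformed_evolution hab.le
    (fun t ht => (hℓ.differentiableOn two_ne_zero t ht).hasDerivWithinAt)
    (fun t ht => (hℓ'.differentiableOn one_ne_zero t ht).hasDerivWithinAt)
    (fun t ht => (hd'.differentiableOn one_ne_zero t ht).hasDerivWithinAt)
    (hℓ'.continuousOn_derivWithin hU le_rfl) (hd'.continuousOn_derivWithin hU le_rfl) hpos
  refine ⟨fun t ht => (hform t ht).isSelfAdjoint, ?_,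
    fun t ht => (hform t ht).formDomain_eq.trans range_embed,
    fun t s => Q t * star (Q s), ⟨isUnitaryPropagator_of_unitary hQ hQc, fun s _ Ψ _ => ?_, ?_⟩, ?_⟩
  -- The lower bound is the maximum over the compact interval of the norm of the scalar potential,
  -- whose coefficients depend only on `ℓ'` and `d'`.
  · obtain ⟨m, hm⟩ := exists_bound_quadPoly positionL
      (p₀ := fun t => -(derivWithin d (Set.Icc a b) t ^ 2 / 4))
      (p₁ := fun t => -(derivWithin ℓ (Set.Icc a b) t * derivWithin d (Set.Icc a b) t / 2))
      (p₂ := fun t => -(derivWithin ℓ (Set.Icc a b) t ^ 2 / 4))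
      ((hd'.continuousOn.pow 2).div_const 4).neg
      ((hℓ'.continuousOn.mul hd'.continuousOn).div_const 2).neg
      ((hℓ'.continuousOn.pow 2).div_const 4).neg
    refine ⟨m, fun t ht Ψ => ?_⟩
    have h := hform t ht
    rw [← h.map_lift Ψ, h.inner_apply]
    refine le_trans ?_ (neg_norm_le_re_inner_magneticForm (by positivity) _ _ _)
    refine mul_le_mul_of_nonneg_right (neg_le_neg ?_) (sq_nonneg _)
    exact (congrArg norm (scalarPotential_eq (hpos t ht) _ _)).trans_le (hm t ht)
  · rw [(Unitary.mem_iff.1 (hQ s)).2, one_apply_eq_self]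
  · rintro s - Ψ hΨ Φ hΦ t ht
    obtain ⟨k, rfl⟩ := range_embed.ge hΨ
    exact (isMagneticSolution_iff (hpos t ht) _ _).1 (hQsol s k t ht) Φ hΦ
  · intro V hV t ht s hs
    -- The weak equation determines a propagator only on `H¹₀`; density and boundedness do the rest.
    have hdense : DenseRange embed := embed_denseRange
    refine ContinuousLinearMap.ext fun x => congrFun (hdense.equalizer (V t s).continuous
      (Q t * star (Q s)).continuous (funext fun k => ?_)) x
    have hk : embed k ∈ (H10 : Set L2) := range_embed.le (Set.mem_range_self k)
    have h1 := hQuniq (fun r => V r s (embed k))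
      ((hV.propagator.strongly_continuous (embed k)).comp
        (continuousOn_id.prodMk continuousOn_const) fun r hr => ⟨hr, hs⟩)
      (fun r hr => (isMagneticSolution_iff (hpos r hr) _ _).2 fun Φ hΦ =>
        hV.equation s hs (embed k) hk Φ hΦ r hr) t ht s hs
    simp only [hV.initial s hs _ hk] at h1
    exact h1
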